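/- Let $d\in\mathbb N$, $0<\alpha<\min(d,2)$, $$\nu(x,y)=\frac{2^{\alpha}\,\Gamma\big(\tfrac{d+\alpha}{2}\big)}{\pi^{d/2}\,|\Gamma(-\tfrac{\alpha}{2})|}\,|y-x|^{-d-\alpha},\qquad x,y\in\mathbb R^d,$$ and for real-valued $u\in L^2(\mathbb R^d)$ let $$\mathcal E(u,u)=\frac12\int_{\mathbb R^d}\int_{\mathbb R^d}[u(x)-u(y)]^2\,\nu(x,y)\,dy\,dx\in[0,\infty].$$ Let $0\le\beta\le \frac d\alpha-1$, $h(x)=|x|^{\alpha(\beta+1)-d}$ and $$C=C(\beta)=\frac{2^{\alpha}\,\Gamma\big(\frac d2-\frac{\alpha\beta}{2}\big)\,\Gamma\big(\frac{\alpha(\beta+1)}{2}\big)}{\Gamma\big(\frac d2-\frac{\alpha(\beta+1)}{2}\big)\,\Gamma\big(\frac{\alpha\beta}{2}\big)},$$ where $1/\Gamma(0)=0$, so that $C(0)=C(\frac d\alpha-1)=0$. Let $u\in L^2(\mathbb R^d)$ and, only in the case when $\beta=0$ and $d<2\alpha$, assume in addition that $\int_{\mathbb R^d}u(x)^2|x|^{-\alpha}\,dx<\infty$.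 Then $$\mathcal E(u,u)=C\int_{\mathbb R^d}\frac{u(x)^2}{|x|^\alpha}\,dx+\frac12\int_{\mathbb R^d}\int_{\mathbb R^d}\left[\frac{u(x)}{h(x)}-\frac{u(y)}{h(y)}\right]^2h(x)h(y)\,\nu(x,y)\,dy\,dx$$ as an equality in $[0,\infty]$, with $0\cdot\infty=0$. Moreover, the maximum of $C(\beta)$ over $0\le\beta\le\frac d\alpha-1$ is attained at $\beta=\frac{d-\alpha}{2\alpha}$ and equals $2^{\alpha}\,\Gamma(\frac{d+\alpha}{4})^2\,\Gamma(\frac{d-\alpha}{4})^{-2}$. -/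

import Mathlib

open MeasureTheory
open scoped ENNReal

noncomputable section

namespace FractionalHardy

/-- The normalizing constant
`2^α Γ((d+α)/2) π^{-d/2} / |Γ(-α/2)|` of the fractional Laplacian. -/
def normConst (d : ℕ) (α : ℝ) : ℝ :=
  2 ^ α * Real.Gamma ((d + α) / 2) * Real.pi ^ (-(d : ℝ) / 2) / |Real.Gamma (-α / 2)|

/-- The jump kernel `ν(x,y) = normConst d α * |y - x|^{-d-α}` (its value on the diagonal, a null
set on which all the differences below vanish, is irrelevant). -/
def nu (d : ℕ) (α : ℝ) (x y : EuclideanSpace ℝ (Fin d)) : ℝ :=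
  normConst d α * ‖y - x‖ ^ (-(d : ℝ) - α)

/-- The Dirichlet form of the fractional Laplacian, with values in `[0, ∞]`:
`½ ∫∫ (u(x) - u(y))² ν(x,y) dy dx`. -/
def dirichletForm (d : ℕ) (α : ℝ) (u : EuclideanSpace ℝ (Fin d) → ℝ) : ℝ≥0∞ :=
  (1 / 2) * ∫⁻ x, ∫⁻ y, ENNReal.ofReal ((u x - u y) ^ 2 * nu d α x y)

/-- The weight `h(x) = |x|^{α(β+1)-d}`. -/
def weight (d : ℕ) (α β : ℝ) (x : EuclideanSpace ℝ (Fin d)) : ℝ :=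
  ‖x‖ ^ (α * (β + 1) - d)

/-- The Hardy integral `∫ u(x)² / |x|^α dx`, with values in `[0, ∞]`. -/
def hardyIntegral (d : ℕ) (α : ℝ) (u : EuclideanSpace ℝ (Fin d) → ℝ) : ℝ≥0∞ :=
  ∫⁻ x, ENNReal.ofReal (u x ^ 2 / ‖x‖ ^ α)

/-- The remainder `½ ∫∫ [u(x)/h(x) - u(y)/h(y)]² h(x) h(y) ν(x,y) dy dx`, with values in
`[0, ∞]`. -/
def remainder (d : ℕ) (α β : ℝ) (u : EuclideanSpace ℝ (Fin d) → ℝ) : ℝ≥0∞ :=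
  (1 / 2) * ∫⁻ x, ∫⁻ y, ENNReal.ofReal
    ((u x / weight d α β x - u y / weight d α β y) ^ 2
      * weight d α β x * weight d α β y * nu d α x y)

/-- The Hardy constant
`2^α Γ(d/2 - αβ/2) Γ(α(β+1)/2) Γ(d/2 - α(β+1)/2)⁻¹ Γ(αβ/2)⁻¹`.
At `β = 0` and at `β = d/α - 1` one of the two reciprocals is `1/Γ` at its zero `0`; as
`Real.Gamma 0 = 0` and `0⁻¹ = 0`, the expression has the right value `0` there. -/
def hardyConst (d : ℕ) (α β : ℝ) : ℝ :=
  2 ^ α * Real.Gamma ((d : ℝ) / 2 - α * β / 2) * Real.Gamma (α * (β + 1) / 2)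
    * (Real.Gamma ((d : ℝ) / 2 - α * (β + 1) / 2))⁻¹ * (Real.Gamma (α * β / 2))⁻¹

end FractionalHardy

end

/-!
The idea is the ground state substitution `u = h v`. Pointwise,
`(u x - u y)² + u(x)² h(y) / h(x) + u(y)² h(x) / h(y) = u(x)² + u(y)² + h(x) h(y) (v x - v y)²`,
so that, formally, the Dirichlet form differs from the remainder by `∫ u² (-Δ)^{α/2} h / h`, and
`(-Δ)^{α/2} h = C |x|^{-α} h` for the power `h(x) = |x|^{-γ}`, `γ = d - α (β + 1)`.

Principal values are avoided by restricting the jump kernel to the pairs `|x| + |y| ≤ n |y - x|`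
(`truncKernel`). The restricted kernels `K_n` are symmetric, rotation invariant and homogeneous, and
they increase to `ν` off the diagonal. Hence `∫ K_n(x, y) (|y| / |x|)^{-γ} dy` equals
`b_n(γ) |x|^{-α}` with a finite number `b_n(γ)` (`truncCoeff`), and integrating the pointwise
identity, all of whose terms are nonnegative, gives an identity for `K_n` with the constant
`b_n(0) - b_n(γ)` (`truncKernel_identity`). When the Hardy integral is finite, the limit `n → ∞` is
monotone convergence together with `b_n(0) - b_n(γ) → C` (`nu_identity`).

The limit of the constants is found by applying the same truncated identity to one explicit pair:
the bilinear energy of `exp (-|x|²)` and `h`. Both `h` and `ν` are superpositions of Gaussians, so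
Tonelli's theorem reduces this energy to Gamma integrals (`lintegral_gaussian_rpow_energy`,
`tendsto_truncCoeff_sub_hardyConst`). Since `γ ↦ b_n(γ)` is convex, the Hardy constant is concave as
a function of `β`; it is also symmetric about the midpoint of its interval, where it is therefore
largest (`hardyConst_le_midpoint`).

When the Hardy integral is infinite, the Dirichlet form is infinite as well: the identity for
bounded `u` gives Hardy's inequality, which passes to the limit along truncations
(`hardyIntegral_lt_top_of_dirichletForm`). If `C > 0` both sides are then infinite. For
`β = d / α - 1` the weight is constant and there is nothing to prove. For `β = 0` and `d ≥ 2 α` it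
remains to see that the remainder is infinite, and this follows from a discrete Hardy inequality for
the means of `u / h` over dyadic shells (`hardyIntegral_lt_top_of_remainder`).
-/

open Set Filter Topology

namespace FractionalHardy

/-! ### Double integrals -/

section DoubleIntegral

variable {X Y : Type*} [MeasurableSpace X] [MeasurableSpace Y] {μ : Measure X} {ν : Measure Y}
  [SFinite ν]

theorem lintegral_lintegral_add {f g : X → Y → ℝ≥0∞} (hf : Measurable (Function.uncurry f)) :
    ∫⁻ x, ∫⁻ y, (f x y + g x y) ∂ν ∂μ = ∫⁻ x, ∫⁻ y, f x y ∂ν ∂μ + ∫⁻ x, ∫⁻ y, g x y ∂ν ∂μ := by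
  have hf' : Measurable fun x => ∫⁻ y, f x y ∂ν := hf.lintegral_prod_right'
  rw [← lintegral_add_left hf']
  exact lintegral_congr fun x => lintegral_add_left (hf.comp measurable_prodMk_left) _

end DoubleIntegral

/-! ### Gamma, Beta and Gaussian integrals -/

theorem lintegral_rpow_mul_exp {p c : ℝ} (hp : 0 < p) (hc : 0 < c) :
    ∫⁻ t in Ioi (0 : ℝ), ENNReal.ofReal (t ^ (p - 1) * Real.exp (-(c * t)))
      = ENNReal.ofReal (Real.Gamma p * c ^ (-p)) := by
  have h := Real.integral_rpow_mul_exp_neg_mul_Ioi hp hc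
  have hi : IntegrableOn (fun t : ℝ => t ^ (p - 1) * Real.exp (-(c * t))) (Ioi 0) := by
    have := integrableOn_rpow_mul_exp_neg_mul_rpow (p := 1) (s := p - 1) (b := c)
      (by linarith) one_pos hc
    simpa using this
  rw [← ofReal_integral_eq_lintegral_ofReal hi, h]
  · rw [one_div, Real.inv_rpow hc.le, Real.rpow_neg hc.le, mul_comm]
  · filter_upwards [ae_restrict_mem measurableSet_Ioi] with t ht
    have : (0 : ℝ) < t := ht
    positivity

theorem lintegral_rpow_mul_exp_sub {p A B : ℝ} (hp : 0 < p) (hA : 0 < A) (hAB : A ≤ B) :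
    ∫⁻ t in Ioi (0 : ℝ), ENNReal.ofReal
        (t ^ (p - 1) * (Real.exp (-(A * t)) - Real.exp (-(B * t))))
      = ENNReal.ofReal (Real.Gamma p * (A ^ (-p) - B ^ (-p))) := by
  have hB : 0 < B := hA.trans_le hAB
  have hsum : ∫⁻ t in Ioi (0 : ℝ), (ENNReal.ofReal
        (t ^ (p - 1) * (Real.exp (-(A * t)) - Real.exp (-(B * t)))) +
        ENNReal.ofReal (t ^ (p - 1) * Real.exp (-(B * t))))
      = ∫⁻ t in Ioi (0 : ℝ), ENNReal.ofReal (t ^ (p - 1) * Real.exp (-(A * t))) := by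
    refine setLIntegral_congr_fun measurableSet_Ioi fun t ht => ?_
    have ht' : (0 : ℝ) < t := ht
    have : Real.exp (-(B * t)) ≤ Real.exp (-(A * t)) := Real.exp_le_exp.2 (by nlinarith)
    have h2 := sub_nonneg.2 this
    rw [← ENNReal.ofReal_add (by positivity) (by positivity)]
    congr 1; ring
  rw [lintegral_add_right _ (by fun_prop), lintegral_rpow_mul_exp hp hA,
    lintegral_rpow_mul_exp hp hB] at hsum
  have hG := Real.Gamma_pos_of_pos hp
  rw [mul_sub, ENNReal.ofReal_sub _ (by positivity), ← hsum,
    ENNReal.add_sub_cancel_right ENNReal.ofReal_ne_top]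

/-- The Beta integral on the half line. -/
theorem lintegral_rpow_mul_add_rpow {p q a : ℝ} (hp : 0 < p) (hq : 0 < q) (ha : 0 < a) :
    ∫⁻ s in Ioi (0 : ℝ), ENNReal.ofReal (s ^ (p - 1) * (a + s) ^ (-(p + q)))
      = ENNReal.ofReal (Real.Gamma p * Real.Gamma q / Real.Gamma (p + q) * a ^ (-q)) := by
  have hG := Real.Gamma_pos_of_pos (add_pos hp hq)
  have hGp := Real.Gamma_pos_of_pos hp
  have hGq := Real.Gamma_pos_of_pos hq
  calc ∫⁻ s in Ioi (0 : ℝ), ENNReal.ofReal (s ^ (p - 1) * (a + s) ^ (-(p + q)))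
      = ∫⁻ s in Ioi (0 : ℝ), ∫⁻ w in Ioi (0 : ℝ), ENNReal.ofReal
          ((Real.Gamma (p + q))⁻¹ * s ^ (p - 1) *
            (w ^ (p + q - 1) * Real.exp (-((a + s) * w)))) := by
        refine setLIntegral_congr_fun measurableSet_Ioi fun s hs => ?_
        have hs' : (0 : ℝ) < s := hs
        have : ∀ w : ℝ, ENNReal.ofReal ((Real.Gamma (p + q))⁻¹ * s ^ (p - 1) *
            (w ^ (p + q - 1) * Real.exp (-((a + s) * w)))) =
            ENNReal.ofReal ((Real.Gamma (p + q))⁻¹ * s ^ (p - 1)) *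
            ENNReal.ofReal (w ^ (p + q - 1) * Real.exp (-((a + s) * w))) := fun w =>
          ENNReal.ofReal_mul (by positivity)
        simp_rw [this]
        rw [lintegral_const_mul _ (by fun_prop), lintegral_rpow_mul_exp (add_pos hp hq)
          (add_pos ha hs'), ← ENNReal.ofReal_mul (by positivity)]
        congr 1; field_simp
    _ = ∫⁻ w in Ioi (0 : ℝ), ∫⁻ s in Ioi (0 : ℝ), ENNReal.ofReal
          ((Real.Gamma (p + q))⁻¹ * s ^ (p - 1) *
            (w ^ (p + q - 1) * Real.exp (-((a + s) * w)))) := by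
        rw [lintegral_lintegral_swap]
        exact Measurable.aemeasurable (by fun_prop)
    _ = ∫⁻ w in Ioi (0 : ℝ), ENNReal.ofReal (Real.Gamma p / Real.Gamma (p + q)) *
          ENNReal.ofReal (w ^ (q - 1) * Real.exp (-(a * w))) := by
        refine setLIntegral_congr_fun measurableSet_Ioi fun w hw => ?_
        have hw' : (0 : ℝ) < w := hw
        have : ∀ s : ℝ, ENNReal.ofReal ((Real.Gamma (p + q))⁻¹ * s ^ (p - 1) *
            (w ^ (p + q - 1) * Real.exp (-((a + s) * w)))) =
            ENNReal.ofReal ((Real.Gamma (p + q))⁻¹ * w ^ (p + q - 1) * Real.exp (-(a * w))) *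
            ENNReal.ofReal (s ^ (p - 1) * Real.exp (-(w * s))) := fun s => by
          rw [← ENNReal.ofReal_mul (by positivity)]
          congr 1
          rw [show -((a + s) * w) = -(a * w) + -(w * s) by ring, Real.exp_add]
          ring
        simp_rw [this]
        rw [lintegral_const_mul _ (by fun_prop), lintegral_rpow_mul_exp hp hw',
          ← ENNReal.ofReal_mul (by positivity), ← ENNReal.ofReal_mul (by positivity)]
        congr 1
        have : w ^ (q - 1) = w ^ (p + q - 1) * w ^ (-p) := by
          rw [← Real.rpow_add hw']; congr 1; ring
        rw [this]; ring
    _ = _ := by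
        rw [lintegral_const_mul _ (by fun_prop), lintegral_rpow_mul_exp hq ha,
          ← ENNReal.ofReal_mul (by positivity)]
        congr 1; ring

/-- The Mellin transform of `1 - exp (-c z)`, obtained from
`1 - exp (-c z) = ∫_0^c z exp (-z w) dw`. -/
theorem lintegral_rpow_mul_one_sub_exp {p c : ℝ} (hp : 0 < p) (hp1 : p < 1) (hc : 0 < c) :
    ∫⁻ z in Ioi (0 : ℝ), ENNReal.ofReal (z ^ (-p - 1) * (1 - Real.exp (-(c * z))))
      = ENNReal.ofReal (Real.Gamma (1 - p) / p * c ^ p) := by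
  have hG := Real.Gamma_pos_of_pos (sub_pos.2 hp1)
  calc ∫⁻ z in Ioi (0 : ℝ), ENNReal.ofReal (z ^ (-p - 1) * (1 - Real.exp (-(c * z))))
      = ∫⁻ z in Ioi (0 : ℝ), ∫⁻ w in Ioc (0 : ℝ) c,
          ENNReal.ofReal (z ^ ((1 - p) - 1) * Real.exp (-(w * z))) := by
        refine setLIntegral_congr_fun measurableSet_Ioi fun z hz => ?_
        have hz' : (0 : ℝ) < z := hz
        have hi : ∫ w in (0 : ℝ)..c, Real.exp (-(w * z)) = (1 - Real.exp (-(c * z))) / z := by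
          have hd : ∀ w ∈ uIcc 0 c, HasDerivAt (fun w : ℝ => -Real.exp (-(w * z)) / z)
              (Real.exp (-(w * z))) w := fun w _ => by
            have h1 : HasDerivAt (fun w : ℝ => -(w * z)) (-z) w := by
              simpa using (hasDerivAt_mul_const z).fun_neg
            have h2 := h1.exp.fun_neg.div_const z
            refine h2.congr_deriv ?_
            rw [mul_neg, neg_neg, mul_div_cancel_right₀ _ hz'.ne']
          rw [intervalIntegral.integral_eq_sub_of_hasDerivAt hd
            (by apply Continuous.intervalIntegrable; fun_prop)]
          simp; ring
        rw [intervalIntegral.integral_of_le hc.le] at hi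
        have : ∀ w : ℝ, ENNReal.ofReal (z ^ ((1 - p) - 1) * Real.exp (-(w * z))) =
            ENNReal.ofReal (z ^ ((1 - p) - 1)) * ENNReal.ofReal (Real.exp (-(w * z))) :=
          fun w => ENNReal.ofReal_mul (by positivity)
        simp_rw [this]
        rw [lintegral_const_mul _ (by fun_prop), ← ofReal_integral_eq_lintegral_ofReal, hi,
          ← ENNReal.ofReal_mul (by positivity)]
        · congr 1
          rw [show (1 - p - 1) = (-p - 1) + 1 by ring, Real.rpow_add_one hz'.ne']
          field_simp
        · exact (Continuous.integrableOn_Icc (by fun_prop)).mono_set Ioc_subset_Icc_self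
        · exact Eventually.of_forall fun w => by positivity
    _ = ∫⁻ w in Ioc (0 : ℝ) c, ∫⁻ z in Ioi (0 : ℝ),
          ENNReal.ofReal (z ^ ((1 - p) - 1) * Real.exp (-(w * z))) := by
        rw [lintegral_lintegral_swap]
        exact Measurable.aemeasurable (by fun_prop)
    _ = ∫⁻ w in Ioc (0 : ℝ) c, ENNReal.ofReal (Real.Gamma (1 - p) * w ^ (p - 1)) := by
        refine setLIntegral_congr_fun measurableSet_Ioc fun w hw => ?_
        rw [lintegral_rpow_mul_exp (sub_pos.2 hp1) hw.1, show -(1 - p) = p - 1 by ring]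
    _ = _ := by
        have h := integral_rpow (a := 0) (b := c) (r := p - 1) (Or.inl (by linarith))
        rw [intervalIntegral.integral_of_le hc.le] at h
        rw [← ofReal_integral_eq_lintegral_ofReal, integral_const_mul, h]
        · congr 1
          rw [sub_add_cancel, Real.zero_rpow hp.ne']; ring
        · refine Integrable.const_mul ?_ _
          exact (intervalIntegrable_iff_integrableOn_Ioc_of_le hc.le).1
            (intervalIntegral.intervalIntegrable_rpow' (by linarith))
        · filter_upwards [ae_restrict_mem measurableSet_Ioc] with w hw
          have := hw.1
          positivity

section Gaussian

variable {V : Type*} [NormedAddCommGroup V] [InnerProductSpace ℝ V] [FiniteDimensional ℝ V]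
  [MeasurableSpace V] [BorelSpace V]

open Module (finrank)

theorem lintegral_gaussian {b : ℝ} (hb : 0 < b) :
    ∫⁻ x : V, ENNReal.ofReal (Real.exp (-(b * ‖x‖ ^ 2)))
      = ENNReal.ofReal ((Real.pi / b) ^ ((finrank ℝ V : ℝ) / 2)) := by
  have h := GaussianFourier.integral_rexp_neg_mul_sq_norm (V := V) hb
  simp only [neg_mul] at h
  rw [← h, ofReal_integral_eq_lintegral_ofReal]
  · refine Integrable.of_integral_ne_zero ?_
    rw [h]
    positivity
  · exact Eventually.of_forall fun w => by positivity

/-- The product of the two Gaussians is a translated Gaussian, by completing the square. -/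
theorem lintegral_gaussian_mul_gaussian {s t : ℝ} (hs : 0 < s) (ht : 0 < t) (x : V) :
    ∫⁻ y : V, ENNReal.ofReal (Real.exp (-(s * ‖y‖ ^ 2)) * Real.exp (-(t * ‖y - x‖ ^ 2)))
      = ENNReal.ofReal ((Real.pi / (s + t)) ^ ((finrank ℝ V : ℝ) / 2) *
          Real.exp (-(s * t / (s + t) * ‖x‖ ^ 2))) := by
  have hst : 0 < s + t := add_pos hs ht
  have key : ∀ y : V, ENNReal.ofReal
      (Real.exp (-(s * ‖y‖ ^ 2)) * Real.exp (-(t * ‖y - x‖ ^ 2))) =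
      ENNReal.ofReal (Real.exp (-((s + t) * ‖y - (t / (s + t)) • x‖ ^ 2))) *
      ENNReal.ofReal (Real.exp (-(s * t / (s + t) * ‖x‖ ^ 2))) := fun y => by
    rw [← ENNReal.ofReal_mul (by positivity), ← Real.exp_add, ← Real.exp_add]
    congr 2
    rw [norm_sub_sq_real, norm_sub_sq_real, inner_smul_right, norm_smul, mul_pow,
      Real.norm_eq_abs, sq_abs]
    field_simp
    ring
  simp_rw [key]
  rw [lintegral_mul_const _ (by fun_prop),
    lintegral_sub_right_eq_self
      (fun y : V => ENNReal.ofReal (Real.exp (-((s + t) * ‖y‖ ^ 2)))),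
    lintegral_gaussian hst, ← ENNReal.ofReal_mul (by positivity)]

theorem exp_sub_mul_exp_sub_nonneg {a s : ℝ} (ha : 0 ≤ a) (hs : 0 ≤ s) (r q : ℝ) :
    0 ≤ (Real.exp (-(a * r)) - Real.exp (-(a * q))) *
      (Real.exp (-(s * r)) - Real.exp (-(s * q))) := by
  rcases le_total r q with h | h
  · exact mul_nonneg (sub_nonneg.2 (Real.exp_le_exp.2 (by nlinarith)))
      (sub_nonneg.2 (Real.exp_le_exp.2 (by nlinarith)))
  · exact mul_nonneg_of_nonpos_of_nonpos (sub_nonpos.2 (Real.exp_le_exp.2 (by nlinarith)))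
      (sub_nonpos.2 (Real.exp_le_exp.2 (by nlinarith)))

/-- The bilinear energy of two centred Gaussians for a Gaussian jump kernel. -/
theorem lintegral_gaussian_energy {a s t : ℝ} (ha : 0 < a) (hs : 0 < s) (ht : 0 < t) :
    ∫⁻ x : V, ∫⁻ y : V, ENNReal.ofReal
        ((Real.exp (-(a * ‖x‖ ^ 2)) - Real.exp (-(a * ‖y‖ ^ 2))) *
          (Real.exp (-(s * ‖x‖ ^ 2)) - Real.exp (-(s * ‖y‖ ^ 2))) *
          Real.exp (-(t * ‖y - x‖ ^ 2)))
      = 2 * ENNReal.ofReal (Real.pi ^ (finrank ℝ V : ℝ) *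
          (((a + s) * t) ^ (-((finrank ℝ V : ℝ) / 2)) -
            (a * s + (a + s) * t) ^ (-((finrank ℝ V : ℝ) / 2)))) := by
  set n : ℝ := (finrank ℝ V : ℝ) with hn
  have hn0 : 0 ≤ n := by positivity
  -- expanding the product: `I1` and `I1'` integrate the diagonal terms, `I2` and `I2'` the mixed
  -- ones
  have I1 : ∫⁻ x : V, ∫⁻ y : V, ENNReal.ofReal
      (Real.exp (-((a + s) * ‖x‖ ^ 2)) * Real.exp (-(t * ‖y - x‖ ^ 2))) =
      ENNReal.ofReal (Real.pi ^ n * ((a + s) * t) ^ (-(n / 2))) := by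
    have : ∀ x : V, ∫⁻ y : V, ENNReal.ofReal
        (Real.exp (-((a + s) * ‖x‖ ^ 2)) * Real.exp (-(t * ‖y - x‖ ^ 2))) =
        ENNReal.ofReal (Real.exp (-((a + s) * ‖x‖ ^ 2))) *
          ENNReal.ofReal ((Real.pi / t) ^ (n / 2)) := fun x => by
      simp_rw [fun y : V => ENNReal.ofReal_mul (q := Real.exp (-(t * ‖y - x‖ ^ 2)))
        (Real.exp_nonneg (-((a + s) * ‖x‖ ^ 2)))]
      rw [lintegral_const_mul _ (by fun_prop), lintegral_sub_right_eq_self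
        (fun y : V => ENNReal.ofReal (Real.exp (-(t * ‖y‖ ^ 2)))), lintegral_gaussian ht]
    simp_rw [this]
    rw [lintegral_mul_const _ (by fun_prop), lintegral_gaussian (by positivity),
      ← ENNReal.ofReal_mul (by positivity), ← hn]
    congr 1
    rw [← Real.mul_rpow (by positivity) (by positivity),
      show Real.pi / (a + s) * (Real.pi / t) = Real.pi ^ (2 : ℝ) * ((a + s) * t)⁻¹ by
        rw [Real.rpow_two]; field_simp,
      Real.mul_rpow (by positivity) (by positivity), ← Real.rpow_mul (by positivity),
      Real.inv_rpow (by positivity), ← Real.rpow_neg (by positivity)]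
    congr 2; ring
  have I2 : ∫⁻ x : V, ∫⁻ y : V, ENNReal.ofReal
      (Real.exp (-(a * ‖x‖ ^ 2)) * (Real.exp (-(s * ‖y‖ ^ 2)) * Real.exp (-(t * ‖y - x‖ ^ 2)))) =
      ENNReal.ofReal (Real.pi ^ n * (a * s + (a + s) * t) ^ (-(n / 2))) := by
    have : ∀ x : V, ∫⁻ y : V, ENNReal.ofReal
        (Real.exp (-(a * ‖x‖ ^ 2)) *
          (Real.exp (-(s * ‖y‖ ^ 2)) * Real.exp (-(t * ‖y - x‖ ^ 2)))) =
        ENNReal.ofReal (Real.exp (-((a + s * t / (s + t)) * ‖x‖ ^ 2))) *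
          ENNReal.ofReal ((Real.pi / (s + t)) ^ (n / 2)) := fun x => by
      simp_rw [fun y : V => ENNReal.ofReal_mul
        (q := Real.exp (-(s * ‖y‖ ^ 2)) * Real.exp (-(t * ‖y - x‖ ^ 2)))
        (Real.exp_nonneg (-(a * ‖x‖ ^ 2)))]
      rw [lintegral_const_mul _ (by fun_prop), lintegral_gaussian_mul_gaussian hs ht,
        ← ENNReal.ofReal_mul (by positivity), ← ENNReal.ofReal_mul (by positivity)]
      congr 1
      rw [show -((a + s * t / (s + t)) * ‖x‖ ^ 2) =
        -(a * ‖x‖ ^ 2) + -(s * t / (s + t) * ‖x‖ ^ 2) by ring, Real.exp_add]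
      ring
    simp_rw [this]
    rw [lintegral_mul_const _ (by fun_prop), lintegral_gaussian (by positivity),
      ← ENNReal.ofReal_mul (by positivity), ← hn]
    congr 1
    rw [← Real.mul_rpow (by positivity) (by positivity),
      show Real.pi / (a + s * t / (s + t)) * (Real.pi / (s + t)) =
          Real.pi ^ (2 : ℝ) * (a * s + (a + s) * t)⁻¹ by
        rw [Real.rpow_two]; field_simp; ring,
      Real.mul_rpow (by positivity) (by positivity), ← Real.rpow_mul (by positivity),
      Real.inv_rpow (by positivity), ← Real.rpow_neg (by positivity)]
    congr 2; ring
  have I1' : ∫⁻ x : V, ∫⁻ y : V, ENNReal.ofReal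
      (Real.exp (-((a + s) * ‖y‖ ^ 2)) * Real.exp (-(t * ‖y - x‖ ^ 2))) =
      ENNReal.ofReal (Real.pi ^ n * ((a + s) * t) ^ (-(n / 2))) := by
    rw [lintegral_lintegral_swap (Measurable.aemeasurable (by fun_prop)), ← I1]
    simp_rw [norm_sub_rev]
  have I2' : ∫⁻ x : V, ∫⁻ y : V, ENNReal.ofReal
      (Real.exp (-(a * ‖y‖ ^ 2)) * (Real.exp (-(s * ‖x‖ ^ 2)) * Real.exp (-(t * ‖y - x‖ ^ 2)))) =
      ENNReal.ofReal (Real.pi ^ n * (a * s + (a + s) * t) ^ (-(n / 2))) := by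
    rw [lintegral_lintegral_swap (Measurable.aemeasurable (by fun_prop)), ← I2]
    simp_rw [norm_sub_rev]
  have hsum : ∀ x y : V, ENNReal.ofReal
        ((Real.exp (-(a * ‖x‖ ^ 2)) - Real.exp (-(a * ‖y‖ ^ 2))) *
          (Real.exp (-(s * ‖x‖ ^ 2)) - Real.exp (-(s * ‖y‖ ^ 2))) *
          Real.exp (-(t * ‖y - x‖ ^ 2))) +
        (ENNReal.ofReal (Real.exp (-(a * ‖x‖ ^ 2)) *
          (Real.exp (-(s * ‖y‖ ^ 2)) * Real.exp (-(t * ‖y - x‖ ^ 2)))) +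
        ENNReal.ofReal (Real.exp (-(a * ‖y‖ ^ 2)) *
          (Real.exp (-(s * ‖x‖ ^ 2)) * Real.exp (-(t * ‖y - x‖ ^ 2))))) =
        ENNReal.ofReal (Real.exp (-((a + s) * ‖x‖ ^ 2)) * Real.exp (-(t * ‖y - x‖ ^ 2))) +
        ENNReal.ofReal (Real.exp (-((a + s) * ‖y‖ ^ 2)) * Real.exp (-(t * ‖y - x‖ ^ 2))) :=
      fun x y => by
    have h0 := mul_nonneg (exp_sub_mul_exp_sub_nonneg ha.le hs.le (‖x‖ ^ 2) (‖y‖ ^ 2))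
      (Real.exp_nonneg (-(t * ‖y - x‖ ^ 2)))
    rw [← ENNReal.ofReal_add (by positivity) (by positivity),
      ← ENNReal.ofReal_add h0 (by positivity),
      ← ENNReal.ofReal_add (by positivity) (by positivity)]
    congr 1
    rw [show ∀ r : ℝ, -((a + s) * r) = -(a * r) + -(s * r) by intro r; ring,
      show ∀ r : ℝ, -((a + s) * r) = -(a * r) + -(s * r) by intro r; ring, Real.exp_add,
      Real.exp_add]
    ring
  have htot := lintegral_congr (μ := (volume : Measure V)) fun x =>
    lintegral_congr (μ := (volume : Measure V)) (hsum x)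
  rw [lintegral_lintegral_add (by fun_prop), lintegral_lintegral_add (by fun_prop),
    lintegral_lintegral_add (by fun_prop), I1, I2, I1', I2'] at htot
  rw [mul_sub, ENNReal.ofReal_sub _ (by positivity), ENNReal.mul_sub (by simp), two_mul,
    two_mul, ← htot, ENNReal.add_sub_cancel_right (by finiteness)]

end Gaussian

theorem sq_rpow_neg_half {r : ℝ} (hr : 0 ≤ r) (δ : ℝ) : (r ^ 2) ^ (-(δ / 2)) = r ^ (-δ) := by
  rw [← Real.rpow_two, ← Real.rpow_mul hr]
  congr 1; ring

section GaussianPower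

variable {V : Type*} [NormedAddCommGroup V] [InnerProductSpace ℝ V] [FiniteDimensional ℝ V]
  [MeasurableSpace V] [BorelSpace V]

open Module (finrank)

theorem ae_ne_zero_of_finrank_pos (hV : 0 < finrank ℝ V) : ∀ᵐ x : V, x ≠ 0 := by
  have : Nontrivial V := Module.finrank_pos_iff.1 hV
  simp [ae_iff, measure_singleton]

/-- Writing the power as a superposition of Gaussians turns the integral into a Beta integral. -/
theorem lintegral_gaussian_mul_rpow {δ : ℝ} (hδ : 0 < δ) (hδ' : δ < finrank ℝ V) :
    ∫⁻ x : V, ENNReal.ofReal (Real.exp (-‖x‖ ^ 2) * ‖x‖ ^ (-δ))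
      = ENNReal.ofReal (Real.pi ^ ((finrank ℝ V : ℝ) / 2) *
          (Real.Gamma (((finrank ℝ V : ℝ) - δ) / 2) / Real.Gamma ((finrank ℝ V : ℝ) / 2))) := by
  set n : ℝ := (finrank ℝ V : ℝ) with hn
  have hV : 0 < finrank ℝ V := by
    have : (0 : ℝ) < n := hδ.trans hδ'
    rw [hn] at this; exact_mod_cast this
  have hG := Real.Gamma_pos_of_pos (half_pos hδ)
  have hG2 := Real.Gamma_pos_of_pos (half_pos (sub_pos.2 hδ'))
  calc ∫⁻ x : V, ENNReal.ofReal (Real.exp (-‖x‖ ^ 2) * ‖x‖ ^ (-δ))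
      = ∫⁻ x : V, ∫⁻ s in Ioi (0 : ℝ), ENNReal.ofReal ((Real.Gamma (δ / 2))⁻¹ *
          Real.exp (-‖x‖ ^ 2) * (s ^ (δ / 2 - 1) * Real.exp (-(‖x‖ ^ 2 * s)))) := by
        refine lintegral_congr_ae ?_
        filter_upwards [ae_ne_zero_of_finrank_pos hV] with x hx
        have hx' : 0 < ‖x‖ ^ 2 := by positivity
        simp_rw [fun s : ℝ => ENNReal.ofReal_mul
          (q := s ^ (δ / 2 - 1) * Real.exp (-(‖x‖ ^ 2 * s)))
          (by positivity : 0 ≤ (Real.Gamma (δ / 2))⁻¹ * Real.exp (-‖x‖ ^ 2))]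
        rw [lintegral_const_mul _ (by fun_prop), lintegral_rpow_mul_exp (half_pos hδ) hx',
          ← ENNReal.ofReal_mul (by positivity), sq_rpow_neg_half (norm_nonneg x)]
        congr 1; field_simp
    _ = ∫⁻ s in Ioi (0 : ℝ), ∫⁻ x : V, ENNReal.ofReal ((Real.Gamma (δ / 2))⁻¹ *
          Real.exp (-‖x‖ ^ 2) * (s ^ (δ / 2 - 1) * Real.exp (-(‖x‖ ^ 2 * s)))) := by
        rw [lintegral_lintegral_swap]
        exact Measurable.aemeasurable (by fun_prop)
    _ = ∫⁻ s in Ioi (0 : ℝ), ENNReal.ofReal (Real.pi ^ (n / 2) * (Real.Gamma (δ / 2))⁻¹) *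
          ENNReal.ofReal (s ^ (δ / 2 - 1) * (1 + s) ^ (-(δ / 2 + (n - δ) / 2))) := by
        refine setLIntegral_congr_fun measurableSet_Ioi fun s hs => ?_
        have hs' : (0 : ℝ) < s := hs
        have : ∀ x : V, ENNReal.ofReal ((Real.Gamma (δ / 2))⁻¹ *
            Real.exp (-‖x‖ ^ 2) * (s ^ (δ / 2 - 1) * Real.exp (-(‖x‖ ^ 2 * s)))) =
            ENNReal.ofReal ((Real.Gamma (δ / 2))⁻¹ * s ^ (δ / 2 - 1)) *
              ENNReal.ofReal (Real.exp (-((1 + s) * ‖x‖ ^ 2))) := fun x => by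
          rw [← ENNReal.ofReal_mul (by positivity),
            show -((1 + s) * ‖x‖ ^ 2) = -‖x‖ ^ 2 + -(‖x‖ ^ 2 * s) by ring, Real.exp_add]
          congr 1; ring
        simp_rw [this]
        rw [lintegral_const_mul _ (by fun_prop), lintegral_gaussian (by positivity),
          ← ENNReal.ofReal_mul (by positivity), ← ENNReal.ofReal_mul (by positivity),
          Real.div_rpow (by positivity) (by positivity), Real.rpow_neg (by positivity), ← hn]
        congr 1
        rw [show δ / 2 + (n - δ) / 2 = n / 2 by ring]
        ring
    _ = _ := by
        rw [lintegral_const_mul _ (by fun_prop), lintegral_rpow_mul_add_rpow (half_pos hδ)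
          (half_pos (sub_pos.2 hδ')) one_pos, ← ENNReal.ofReal_mul (by positivity),
          show δ / 2 + (n - δ) / 2 = n / 2 by ring, Real.one_rpow]
        congr 1; field_simp

theorem lintegral_gaussian_mul_rpow_lt_top {δ : ℝ} (hδ : 0 ≤ δ) (hδ' : δ < finrank ℝ V) :
    ∫⁻ x : V, ENNReal.ofReal (Real.exp (-‖x‖ ^ 2) * ‖x‖ ^ (-δ)) < ⊤ := by
  rcases hδ.eq_or_lt with rfl | hδ
  · have := lintegral_gaussian (V := V) one_pos
    simp only [one_mul] at this
    simp only [neg_zero, Real.rpow_zero, mul_one, this]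
    exact ENNReal.ofReal_lt_top
  · rw [lintegral_gaussian_mul_rpow hδ hδ']
    exact ENNReal.ofReal_lt_top

end GaussianPower

/-! ### Homogeneous truncations of the jump kernel -/

theorem normConst_pos {d : ℕ} {α : ℝ} (hα : 0 < α) (hα2 : α < 2) : 0 < normConst d α := by
  have h1 : 0 < Real.Gamma ((d + α) / 2) := Real.Gamma_pos_of_pos (by positivity)
  have h2 : Real.Gamma (-α / 2) ≠ 0 := by
    refine Real.Gamma_ne_zero fun m hm => ?_
    have h3 : (m : ℝ) = α / 2 := by linarith
    have h4 : (m : ℝ) < 1 := by linarith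
    have h5 : (0 : ℝ) < m := by linarith
    norm_cast at h4 h5
    lia
  have h3 := abs_pos.2 h2
  unfold normConst
  positivity

section Kernel

variable {d : ℕ} {α : ℝ}

theorem nu_nonneg (hα : 0 < α) (hα2 : α < 2) (x y : EuclideanSpace ℝ (Fin d)) :
    0 ≤ nu d α x y :=
  mul_nonneg (normConst_pos hα hα2).le (by positivity)

theorem nu_comm (x y : EuclideanSpace ℝ (Fin d)) : nu d α x y = nu d α y x := by
  rw [nu, nu, norm_sub_rev]

@[fun_prop]
theorem measurable_nu : Measurable (fun p : EuclideanSpace ℝ (Fin d) × EuclideanSpace ℝ (Fin d) =>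
    nu d α p.1 p.2) := by
  unfold nu
  fun_prop

/-- The jump kernel restricted to the pairs with `|x| + |y| ≤ n |y - x|`. The restriction removes
the singularity on the diagonal, while the kernel stays symmetric, rotation invariant and
homogeneous of degree `-d - α`. -/
noncomputable def truncKernel (d : ℕ) (α : ℝ) (n : ℕ) (x y : EuclideanSpace ℝ (Fin d)) : ℝ≥0∞ :=
  if ‖x‖ + ‖y‖ ≤ n * ‖y - x‖ then ENNReal.ofReal (nu d α x y) else 0

theorem truncKernel_comm (n : ℕ) (x y : EuclideanSpace ℝ (Fin d)) :
    truncKernel d α n x y = truncKernel d α n y x := by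
  rw [truncKernel, truncKernel, nu_comm, norm_sub_rev, add_comm]

theorem measurable_truncKernel (n : ℕ) :
    Measurable (Function.uncurry (truncKernel d α n)) := by
  unfold truncKernel Function.uncurry
  refine Measurable.ite (measurableSet_le (by fun_prop) (by fun_prop)) ?_ measurable_const
  exact measurable_nu.ennreal_ofReal

theorem truncKernel_mono (x y : EuclideanSpace ℝ (Fin d)) :
    Monotone fun n => truncKernel d α n x y := by
  intro m n hmn
  simp only [truncKernel]
  split_ifs with h1 h2
  · exact le_rfl
  · refine absurd (h1.trans ?_) h2
    have : (m : ℝ) ≤ n := by exact_mod_cast hmn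
    gcongr
  · exact zero_le
  · exact le_rfl

theorem tendsto_truncKernel {x y : EuclideanSpace ℝ (Fin d)} (hxy : x ≠ y) :
    Tendsto (fun n => truncKernel d α n x y) atTop (𝓝 (ENNReal.ofReal (nu d α x y))) := by
  have h : 0 < ‖y - x‖ := norm_pos_iff.2 (sub_ne_zero.2 hxy.symm)
  obtain ⟨N, hN⟩ := exists_nat_ge ((‖x‖ + ‖y‖) / ‖y - x‖)
  refine tendsto_const_nhds.congr' ?_
  filter_upwards [eventually_ge_atTop N] with n hn
  rw [truncKernel, if_pos]
  have : (N : ℝ) ≤ n := by exact_mod_cast hn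
  exact (div_le_iff₀ h).1 (hN.trans this)

/-- On the support of the restricted kernel, `|y - x|` is at least `(|x| + |y|) / n`. -/
theorem truncKernel_le (hα : 0 < α) (hα2 : α < 2) (n : ℕ) {x : EuclideanSpace ℝ (Fin d)}
    (hx : ‖x‖ = 1) (y : EuclideanSpace ℝ (Fin d)) :
    truncKernel d α n x y ≤
      ENNReal.ofReal (normConst d α * n ^ (d + α : ℝ) * (1 + ‖y‖) ^ (-(d + α : ℝ))) := by
  have hN : 0 < normConst d α := normConst_pos hα hα2
  rw [truncKernel]
  split_ifs with h
  · refine ENNReal.ofReal_le_ofReal ?_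
    rw [hx] at h
    have hy : 0 < 1 + ‖y‖ := by positivity
    have h0 : 0 < n * ‖y - x‖ := hy.trans_le h
    have hn : (0 : ℝ) < n := pos_of_mul_pos_left h0 (norm_nonneg _)
    have hxy : 0 < ‖y - x‖ := pos_of_mul_pos_right h0 hn.le
    have h2 := Real.rpow_le_rpow_of_nonpos hy h (by linarith [d.cast_nonneg (α := ℝ)] :
      -(d + α : ℝ) ≤ 0)
    rw [Real.mul_rpow hn.le hxy.le] at h2
    rw [nu, mul_assoc, show -(d : ℝ) - α = -(d + α : ℝ) by ring]
    refine mul_le_mul_of_nonneg_left ?_ hN.le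
    calc ‖y - x‖ ^ (-(d + α : ℝ))
        = (n : ℝ) ^ (d + α : ℝ) * ((n : ℝ) ^ (-(d + α : ℝ)) * ‖y - x‖ ^ (-(d + α : ℝ))) := by
          rw [← mul_assoc, ← Real.rpow_add hn, add_neg_cancel, Real.rpow_zero, one_mul]
      _ ≤ _ := by gcongr
  · exact zero_le

theorem truncKernel_smul_map (n : ℕ) {r : ℝ} (hr : 0 < r)
    (R : EuclideanSpace ℝ (Fin d) ≃ₗᵢ[ℝ] EuclideanSpace ℝ (Fin d))
    (x y : EuclideanSpace ℝ (Fin d)) :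
    truncKernel d α n (r • R x) (r • R y) =
      ENNReal.ofReal (r ^ (-(d : ℝ) - α)) * truncKernel d α n x y := by
  have h1 : ‖r • R y - r • R x‖ = r * ‖y - x‖ := by
    rw [← smul_sub, ← map_sub, norm_smul, R.norm_map, Real.norm_of_nonneg hr.le]
  have h2 : ∀ z, ‖r • R z‖ = r * ‖z‖ := fun z => by
    rw [norm_smul, R.norm_map, Real.norm_of_nonneg hr.le]
  simp only [truncKernel, nu, h1, h2]
  have h3 : r * ‖x‖ + r * ‖y‖ ≤ n * (r * ‖y - x‖) ↔ ‖x‖ + ‖y‖ ≤ n * ‖y - x‖ := by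
    rw [← mul_add, mul_left_comm]
    exact mul_le_mul_iff_right₀ hr
  rw [if_congr h3 rfl rfl, mul_ite, mul_zero]
  congr 1
  rw [← ENNReal.ofReal_mul (by positivity), Real.mul_rpow hr.le (norm_nonneg _)]
  congr 1; ring

/-- The integral `∫ K_n(e, y) |y|^{-γ} dy` of the truncated kernel; it is used for unit vectors
`e`, on which it depends only through `|e| = 1`. -/
noncomputable def truncCoeff (d : ℕ) (α γ : ℝ) (n : ℕ) (e : EuclideanSpace ℝ (Fin d)) : ℝ≥0∞ :=
  ∫⁻ y, truncKernel d α n e y * ENNReal.ofReal (‖y‖ ^ (-γ))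

theorem lintegral_eq_lintegral_smul_map (f : EuclideanSpace ℝ (Fin d) → ℝ≥0∞) (hf : Measurable f)
    {r : ℝ} (hr : 0 < r) (R : EuclideanSpace ℝ (Fin d) ≃ₗᵢ[ℝ] EuclideanSpace ℝ (Fin d)) :
    ∫⁻ y, f y = ENNReal.ofReal (r ^ (d : ℝ)) * ∫⁻ y, f (r • R y) := by
  have h1 : ∫⁻ y, f (r • R y) = ∫⁻ y, f (r • y) :=
    R.measurePreserving.lintegral_comp (f := fun y => f (r • y)) (by fun_prop)
  have h2 : ∫⁻ y, f (r • y) = ENNReal.ofReal (r ^ (d : ℝ))⁻¹ * ∫⁻ y, f y := by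
    rw [← lintegral_map hf (by fun_prop : Measurable fun y : EuclideanSpace ℝ (Fin d) => r • y),
      Measure.map_addHaar_smul _ hr.ne', lintegral_smul_measure, finrank_euclideanSpace_fin,
      abs_of_nonneg (by positivity), Real.rpow_natCast, smul_eq_mul]
  rw [h1, h2, ← mul_assoc, ← ENNReal.ofReal_mul (by positivity), mul_inv_cancel₀ (by positivity),
    ENNReal.ofReal_one, one_mul]

/-- By rotation invariance and homogeneity, the integral of the truncated kernel against a power
is a multiple of `|x|^{-α}`. -/
theorem lintegral_truncKernel_mul (γ : ℝ) (n : ℕ) {e x : EuclideanSpace ℝ (Fin d)}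
    (he : ‖e‖ = 1) (hx : x ≠ 0) :
    ∫⁻ y, truncKernel d α n x y * ENNReal.ofReal ((‖y‖ / ‖x‖) ^ (-γ)) =
      ENNReal.ofReal (‖x‖ ^ (-α)) * truncCoeff d α γ n e := by
  have hr : 0 < ‖x‖ := norm_pos_iff.2 hx
  have hn : ‖e‖ = ‖(‖x‖)⁻¹ • x‖ := by
    rw [he, norm_smul, norm_inv, norm_norm, inv_mul_cancel₀ hr.ne']
  set R := (ℝ ∙ (e - (‖x‖)⁻¹ • x))ᗮ.reflection
  have hR : R e = (‖x‖)⁻¹ • x := Submodule.reflection_sub hn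
  have hx' : x = ‖x‖ • R e := by rw [hR, smul_inv_smul₀ hr.ne']
  have hK : Measurable (truncKernel d α n x) := (measurable_truncKernel n).of_uncurry_left
  rw [lintegral_eq_lintegral_smul_map _ (by fun_prop) hr R, truncCoeff]
  have : ∀ y, truncKernel d α n x (‖x‖ • R y) * ENNReal.ofReal ((‖‖x‖ • R y‖ / ‖x‖) ^ (-γ)) =
      ENNReal.ofReal (‖x‖ ^ (-(d : ℝ) - α)) *
        (truncKernel d α n e y * ENNReal.ofReal (‖y‖ ^ (-γ))) := fun y => by
    have h1 : ‖‖x‖ • R y‖ / ‖x‖ = ‖y‖ := by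
      rw [norm_smul, R.norm_map, norm_norm, mul_div_cancel_left₀ _ hr.ne']
    rw [h1, ← mul_assoc, ← truncKernel_smul_map n hr R, ← hx']
  have hK' : Measurable (truncKernel d α n e) := (measurable_truncKernel n).of_uncurry_left
  simp_rw [this]
  rw [lintegral_const_mul _ (by fun_prop), ← mul_assoc, ← ENNReal.ofReal_mul (by positivity),
    ← Real.rpow_add hr]
  congr 3; ring

theorem truncCoeff_lt_top (hα : 0 < α) (hα2 : α < 2) {γ : ℝ} (hγ : 0 ≤ γ) (hγd : γ < d) (n : ℕ)
    {e : EuclideanSpace ℝ (Fin d)} (he : ‖e‖ = 1) : truncCoeff d α γ n e < ⊤ := by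
  have hN : 0 < normConst d α := normConst_pos hα hα2
  set A : ℝ := normConst d α * n ^ (d + α : ℝ) with hA
  have hA0 : 0 ≤ A := by positivity
  have h1 := finite_integral_one_add_norm (μ := (volume : Measure (EuclideanSpace ℝ (Fin d))))
    (r := d + α) (by simpa using hα)
  have h2 := lintegral_gaussian_mul_rpow_lt_top (V := EuclideanSpace ℝ (Fin d)) hγ
    (by simpa using hγd)
  have hle : ∀ y : EuclideanSpace ℝ (Fin d),
      truncKernel d α n e y * ENNReal.ofReal (‖y‖ ^ (-γ)) ≤
      ENNReal.ofReal A * (ENNReal.ofReal ((1 + ‖y‖) ^ (-(d + α : ℝ))) +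
        ENNReal.ofReal (Real.exp 1) *
          ENNReal.ofReal (Real.exp (-‖y‖ ^ 2) * ‖y‖ ^ (-γ))) := fun y => by
    refine (mul_le_mul_left (truncKernel_le hα hα2 n he y) _).trans ?_
    rw [← hA, ← ENNReal.ofReal_mul (by positivity), ← ENNReal.ofReal_mul (by positivity),
      ← ENNReal.ofReal_add (by positivity) (by positivity), ← ENNReal.ofReal_mul (by positivity)]
    refine ENNReal.ofReal_le_ofReal ?_
    rw [mul_assoc]
    refine mul_le_mul_of_nonneg_left ?_ hA0
    -- near the origin the kernel is bounded, away from it the power is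
    rcases le_total ‖y‖ 1 with hy | hy
    · have h3 : (1 + ‖y‖) ^ (-(d + α : ℝ)) ≤ 1 :=
        Real.rpow_le_one_of_one_le_of_nonpos (by linarith [norm_nonneg y]) (by
          linarith [d.cast_nonneg (α := ℝ)])
      have h4 : 1 ≤ Real.exp 1 * Real.exp (-‖y‖ ^ 2) := by
        rw [← Real.exp_add]
        exact Real.one_le_exp (by nlinarith [norm_nonneg y])
      calc (1 + ‖y‖) ^ (-(d + α : ℝ)) * ‖y‖ ^ (-γ)
          ≤ 1 * ‖y‖ ^ (-γ) := by gcongr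
        _ ≤ Real.exp 1 * Real.exp (-‖y‖ ^ 2) * ‖y‖ ^ (-γ) := by gcongr
        _ ≤ _ := by
          rw [mul_assoc]
          exact le_add_of_nonneg_left (by positivity)
    · have h3 : ‖y‖ ^ (-γ) ≤ 1 := Real.rpow_le_one_of_one_le_of_nonpos hy (by linarith)
      calc (1 + ‖y‖) ^ (-(d + α : ℝ)) * ‖y‖ ^ (-γ)
          ≤ (1 + ‖y‖) ^ (-(d + α : ℝ)) * 1 := by gcongr
        _ ≤ _ := by
          rw [mul_one]
          exact le_add_of_nonneg_right (by positivity)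
  refine (lintegral_mono hle).trans_lt ?_
  rw [lintegral_const_mul _ (by fun_prop), lintegral_add_left (by fun_prop),
    lintegral_const_mul _ (by fun_prop)]
  finiteness

end Kernel

/-! ### The ground state identity for truncated kernels and its limit -/

section Identity

variable {d : ℕ} {α : ℝ}

theorem lintegral_lintegral_truncKernel (γ : ℝ) (n : ℕ) (hd : 0 < d)
    {e : EuclideanSpace ℝ (Fin d)} (he : ‖e‖ = 1) {F : EuclideanSpace ℝ (Fin d) → ℝ}
    (hF : Measurable F) (hF0 : ∀ x, 0 ≤ F x) :
    ∫⁻ x, ∫⁻ y, ENNReal.ofReal (F x * (‖y‖ / ‖x‖) ^ (-γ)) * truncKernel d α n x y =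
      truncCoeff d α γ n e * ∫⁻ x, ENNReal.ofReal (F x * ‖x‖ ^ (-α)) := by
  rw [← lintegral_const_mul _ (by fun_prop)]
  refine lintegral_congr_ae ?_
  filter_upwards [ae_ne_zero_of_finrank_pos (V := EuclideanSpace ℝ (Fin d)) (by simpa using hd)]
    with x hx
  have hK : Measurable (truncKernel d α n x) := (measurable_truncKernel n).of_uncurry_left
  calc ∫⁻ y, ENNReal.ofReal (F x * (‖y‖ / ‖x‖) ^ (-γ)) * truncKernel d α n x y
      = ∫⁻ y, ENNReal.ofReal (F x) *
          (truncKernel d α n x y * ENNReal.ofReal ((‖y‖ / ‖x‖) ^ (-γ))) :=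
        lintegral_congr fun y => by
          rw [ENNReal.ofReal_mul (hF0 x), mul_assoc, mul_comm (truncKernel d α n x y)]
    _ = _ := by
        rw [lintegral_const_mul _ (by fun_prop), lintegral_truncKernel_mul γ n he hx,
          ENNReal.ofReal_mul (hF0 x)]
        ring

/-- Integrated form, for the truncated kernels, of a pointwise identity between two nonnegative
densities `S` and `T`. All terms are nonnegative, so no integrability is needed. -/
theorem truncKernel_identity {γ : ℝ} (n : ℕ) (hd : 0 < d)
    {e : EuclideanSpace ℝ (Fin d)} (he : ‖e‖ = 1) {F : EuclideanSpace ℝ (Fin d) → ℝ}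
    (hF : Measurable F) (hF0 : ∀ x, 0 ≤ F x)
    {S T : EuclideanSpace ℝ (Fin d) → EuclideanSpace ℝ (Fin d) → ℝ}
    (hS : Measurable (Function.uncurry S)) (hS0 : ∀ x y, x ≠ 0 → y ≠ 0 → 0 ≤ S x y)
    (hT0 : ∀ x y, x ≠ 0 → y ≠ 0 → 0 ≤ T x y)
    (hST : ∀ x y, x ≠ 0 → y ≠ 0 →
      S x y + (F x * (‖y‖ / ‖x‖) ^ (-γ) + F y * (‖x‖ / ‖y‖) ^ (-γ)) = (F x + F y) + T x y) :
    (∫⁻ x, ∫⁻ y, ENNReal.ofReal (S x y) * truncKernel d α n x y) +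
        2 * (truncCoeff d α γ n e * ∫⁻ x, ENNReal.ofReal (F x * ‖x‖ ^ (-α))) =
      2 * (truncCoeff d α 0 n e * ∫⁻ x, ENNReal.ofReal (F x * ‖x‖ ^ (-α))) +
        ∫⁻ x, ∫⁻ y, ENNReal.ofReal (T x y) * truncKernel d α n x y := by
  have hK := measurable_truncKernel (d := d) (α := α) n
  have h0 := ae_ne_zero_of_finrank_pos (V := EuclideanSpace ℝ (Fin d)) (by simpa using hd)
  set g : ℝ → EuclideanSpace ℝ (Fin d) → EuclideanSpace ℝ (Fin d) → ℝ≥0∞ := fun δ x y =>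
    ENNReal.ofReal (F x * (‖y‖ / ‖x‖) ^ (-δ)) * truncKernel d α n x y with hg
  have hgm : ∀ δ, Measurable (Function.uncurry (g δ)) := fun δ =>
    (by fun_prop : Measurable fun p : EuclideanSpace ℝ (Fin d) × EuclideanSpace ℝ (Fin d) =>
      ENNReal.ofReal (F p.1 * (‖p.2‖ / ‖p.1‖) ^ (-δ))).mul hK
  have hgm' : ∀ δ, Measurable (Function.uncurry fun x y => g δ y x) := fun δ =>
    (hgm δ).comp measurable_swap
  have hI : ∀ δ, ∫⁻ x, ∫⁻ y, g δ x y =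
      truncCoeff d α δ n e * ∫⁻ x, ENNReal.ofReal (F x * ‖x‖ ^ (-α)) := fun δ =>
    lintegral_lintegral_truncKernel δ n hd he hF hF0
  have hI' : ∀ δ, ∫⁻ x, ∫⁻ y, (g δ x y + g δ y x) =
      2 * (truncCoeff d α δ n e * ∫⁻ x, ENNReal.ofReal (F x * ‖x‖ ^ (-α))) := fun δ => by
    rw [lintegral_lintegral_add (hgm δ),
      lintegral_lintegral_swap (f := fun x y => g δ y x) (hgm' δ).aemeasurable, hI, two_mul]
  have hSm : Measurable (Function.uncurry fun x y =>
      ENNReal.ofReal (S x y) * truncKernel d α n x y) := hS.ennreal_ofReal.mul hK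
  rw [← hI', ← hI', ← lintegral_lintegral_add hSm,
    ← lintegral_lintegral_add (f := fun x y => g 0 x y + g 0 y x) ((hgm 0).add (hgm' 0))]
  refine lintegral_congr_ae ?_
  filter_upwards [h0] with x hx
  refine lintegral_congr_ae ?_
  filter_upwards [h0] with y hy
  have hFx := hF0 x
  have hFy := hF0 y
  simp only [hg, neg_zero, Real.rpow_zero, mul_one]
  rw [truncKernel_comm n y x, ← add_mul, ← add_mul, ← add_mul, ← add_mul,
    ← ENNReal.ofReal_add (by positivity) (by positivity),
    ← ENNReal.ofReal_add (hS0 x y hx hy) (by positivity),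
    ← ENNReal.ofReal_add hFx hFy, ← ENNReal.ofReal_add (by positivity) (hT0 x y hx hy), hST x y hx hy]

theorem tendsto_lintegral_truncKernel (hα : 0 < α) (hα2 : α < 2)
    {S : EuclideanSpace ℝ (Fin d) → EuclideanSpace ℝ (Fin d) → ℝ}
    (hS : Measurable (Function.uncurry S)) (hS0 : ∀ x, S x x = 0) :
    Tendsto (fun n => ∫⁻ x, ∫⁻ y, ENNReal.ofReal (S x y) * truncKernel d α n x y) atTop
      (𝓝 (∫⁻ x, ∫⁻ y, ENNReal.ofReal (S x y * nu d α x y))) := by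
  have hm : ∀ n, Measurable (Function.uncurry fun x y =>
      ENNReal.ofReal (S x y) * truncKernel d α n x y) := fun n =>
    hS.ennreal_ofReal.mul (measurable_truncKernel n)
  have hmono : ∀ x y, Monotone fun n => ENNReal.ofReal (S x y) * truncKernel d α n x y :=
    fun x y m n hmn => mul_le_mul_right (truncKernel_mono x y hmn) _
  refine lintegral_tendsto_of_tendsto_of_monotone
    (fun n => ((hm n).lintegral_prod_right').aemeasurable)
    (Eventually.of_forall fun x m n hmn => lintegral_mono fun y => hmono x y hmn)
    (Eventually.of_forall fun x => ?_)
  refine lintegral_tendsto_of_tendsto_of_monotone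
    (fun n => ((hm n).of_uncurry_left (x := x)).aemeasurable)
    (Eventually.of_forall fun y => hmono x y) (Eventually.of_forall fun y => ?_)
  rcases eq_or_ne x y with rfl | hxy
  · simp [hS0]
  · rw [ENNReal.ofReal_mul' (nu_nonneg hα hα2 x y)]
    exact ENNReal.Tendsto.const_mul (tendsto_truncKernel hxy) (Or.inr ENNReal.ofReal_ne_top)

theorem lintegral_truncKernel_le (hα : 0 < α) (hα2 : α < 2)
    {S : EuclideanSpace ℝ (Fin d) → EuclideanSpace ℝ (Fin d) → ℝ} (n : ℕ) :
    ∫⁻ x, ∫⁻ y, ENNReal.ofReal (S x y) * truncKernel d α n x y ≤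
      ∫⁻ x, ∫⁻ y, ENNReal.ofReal (S x y * nu d α x y) := by
  refine lintegral_mono fun x => lintegral_mono fun y => ?_
  rw [ENNReal.ofReal_mul' (nu_nonneg hα hα2 x y), truncKernel]
  refine mul_le_mul_right ?_ _
  split_ifs
  · exact le_rfl
  · exact zero_le

/-- The limit of the truncated constants is determined by one explicit pair of energies. -/
theorem tendsto_truncCoeff_sub (hα : 0 < α) (hα2 : α < 2) {γ : ℝ} (hγ : 0 ≤ γ) (hγd : γ < d)
    {e : EuclideanSpace ℝ (Fin d)} (he : ‖e‖ = 1) {F : EuclideanSpace ℝ (Fin d) → ℝ}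
    (hF : Measurable F) (hF0 : ∀ x, 0 ≤ F x)
    {S T : EuclideanSpace ℝ (Fin d) → EuclideanSpace ℝ (Fin d) → ℝ}
    (hS : Measurable (Function.uncurry S)) (hT : Measurable (Function.uncurry T))
    (hS0 : ∀ x y, x ≠ 0 → y ≠ 0 → 0 ≤ S x y)
    (hT0 : ∀ x y, x ≠ 0 → y ≠ 0 → 0 ≤ T x y)
    (hSd : ∀ x, S x x = 0) (hTd : ∀ x, T x x = 0)
    (hST : ∀ x y, x ≠ 0 → y ≠ 0 →
      S x y + (F x * (‖y‖ / ‖x‖) ^ (-γ) + F y * (‖x‖ / ‖y‖) ^ (-γ)) = (F x + F y) + T x y)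
    (hP : ∫⁻ x, ENNReal.ofReal (F x * ‖x‖ ^ (-α)) ≠ ⊤)
    (hP0 : ∫⁻ x, ENNReal.ofReal (F x * ‖x‖ ^ (-α)) ≠ 0)
    (hSf : ∫⁻ x, ∫⁻ y, ENNReal.ofReal (S x y * nu d α x y) ≠ ⊤)
    (hTf : ∫⁻ x, ∫⁻ y, ENNReal.ofReal (T x y * nu d α x y) ≠ ⊤) :
    Tendsto (fun n => (truncCoeff d α 0 n e).toReal - (truncCoeff d α γ n e).toReal) atTop
      (𝓝 (((∫⁻ x, ∫⁻ y, ENNReal.ofReal (S x y * nu d α x y)).toReal -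
        (∫⁻ x, ∫⁻ y, ENNReal.ofReal (T x y * nu d α x y)).toReal) /
        (2 * (∫⁻ x, ENNReal.ofReal (F x * ‖x‖ ^ (-α))).toReal))) := by
  have hd' : (0 : ℝ) < d := hγ.trans_lt hγd
  have hd : 0 < d := by exact_mod_cast hd'
  set P := ∫⁻ x, ENNReal.ofReal (F x * ‖x‖ ^ (-α)) with hPdef
  have hPpos : 0 < P.toReal := ENNReal.toReal_pos hP0 hP
  have hlim := (((ENNReal.tendsto_toReal hSf).comp
    (tendsto_lintegral_truncKernel hα hα2 hS hSd)).sub ((ENNReal.tendsto_toReal hTf).comp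
    (tendsto_lintegral_truncKernel hα hα2 hT hTd))).div_const (2 * P.toReal)
  refine hlim.congr fun n => ?_
  have hid := truncKernel_identity (α := α) n hd he hF hF0 hS hS0 hT0 hST
  have hSn := ((lintegral_truncKernel_le hα hα2 (S := S) n).trans_lt hSf.lt_top).ne
  have hTn := ((lintegral_truncKernel_le hα hα2 (S := T) n).trans_lt hTf.lt_top).ne
  have ha := (truncCoeff_lt_top hα hα2 le_rfl hd' n he).ne
  have hb := (truncCoeff_lt_top hα hα2 hγ hγd n he).ne
  rw [← hPdef] at hid
  have hid' := congrArg ENNReal.toReal hid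
  rw [ENNReal.toReal_add hSn (by finiteness), ENNReal.toReal_add (by finiteness) hTn,
    ENNReal.toReal_mul, ENNReal.toReal_mul, ENNReal.toReal_mul, ENNReal.toReal_mul,
    ENNReal.toReal_ofNat] at hid'
  simp only [Function.comp_apply]
  rw [div_eq_iff (by positivity)]
  linarith

/-- The limit of the truncated identities, once the truncated constants converge. -/
theorem nu_identity (hα : 0 < α) (hα2 : α < 2) {γ : ℝ} (hγ : 0 ≤ γ) (hγd : γ < d)
    {e : EuclideanSpace ℝ (Fin d)} (he : ‖e‖ = 1) {F : EuclideanSpace ℝ (Fin d) → ℝ}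
    (hF : Measurable F) (hF0 : ∀ x, 0 ≤ F x)
    {S T : EuclideanSpace ℝ (Fin d) → EuclideanSpace ℝ (Fin d) → ℝ}
    (hS : Measurable (Function.uncurry S)) (hT : Measurable (Function.uncurry T))
    (hS0 : ∀ x y, x ≠ 0 → y ≠ 0 → 0 ≤ S x y)
    (hT0 : ∀ x y, x ≠ 0 → y ≠ 0 → 0 ≤ T x y)
    (hSd : ∀ x, S x x = 0) (hTd : ∀ x, T x x = 0)
    (hST : ∀ x y, x ≠ 0 → y ≠ 0 →
      S x y + (F x * (‖y‖ / ‖x‖) ^ (-γ) + F y * (‖x‖ / ‖y‖) ^ (-γ)) = (F x + F y) + T x y)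
    (hP : ∫⁻ x, ENNReal.ofReal (F x * ‖x‖ ^ (-α)) ≠ ⊤) {c : ℝ} (hc : 0 ≤ c)
    (hlim : Tendsto (fun n => (truncCoeff d α 0 n e).toReal - (truncCoeff d α γ n e).toReal) atTop
      (𝓝 c)) :
    ∫⁻ x, ∫⁻ y, ENNReal.ofReal (S x y * nu d α x y) =
      2 * (ENNReal.ofReal c * ∫⁻ x, ENNReal.ofReal (F x * ‖x‖ ^ (-α))) +
        ∫⁻ x, ∫⁻ y, ENNReal.ofReal (T x y * nu d α x y) := by
  have hd' : (0 : ℝ) < d := hγ.trans_lt hγd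
  have hd : 0 < d := by exact_mod_cast hd'
  set P := ∫⁻ x, ENNReal.ofReal (F x * ‖x‖ ^ (-α)) with hPdef
  set A : ℕ → ℝ := fun n => (truncCoeff d α 0 n e).toReal with hA
  set B : ℕ → ℝ := fun n => (truncCoeff d α γ n e).toReal with hB
  have hA0 : ∀ n, 0 ≤ A n := fun n => ENNReal.toReal_nonneg
  have hB0 : ∀ n, 0 ≤ B n := fun n => ENNReal.toReal_nonneg
  -- the finite parts of the two coefficients are cancelled
  have hid : ∀ n, (∫⁻ x, ∫⁻ y, ENNReal.ofReal (S x y) * truncKernel d α n x y) +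
        2 * (ENNReal.ofReal (B n - A n) * P) =
      2 * (ENNReal.ofReal (A n - B n) * P) +
        ∫⁻ x, ∫⁻ y, ENNReal.ofReal (T x y) * truncKernel d α n x y := fun n => by
    have h := truncKernel_identity (α := α) n hd he hF hF0 hS hS0 hT0 hST
    have ha := (truncCoeff_lt_top hα hα2 le_rfl hd' n he).ne
    have hb := (truncCoeff_lt_top hα hα2 hγ hγd n he).ne
    rw [← hPdef, ← ENNReal.ofReal_toReal ha, ← ENNReal.ofReal_toReal hb] at h
    change _ + 2 * (ENNReal.ofReal (B n) * P) = 2 * (ENNReal.ofReal (A n) * P) + _ at h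
    rcases le_total (A n) (B n) with hab | hab
    · rw [ENNReal.ofReal_of_nonpos (sub_nonpos.2 hab), zero_mul, mul_zero, zero_add]
      rw [show B n = (B n - A n) + A n by ring, ENNReal.ofReal_add (sub_nonneg.2 hab) (hA0 n),
        add_mul, mul_add, ← add_assoc,
        add_comm (2 * (ENNReal.ofReal (A n) * P)) (∫⁻ x, ∫⁻ y, _)] at h
      exact (ENNReal.add_left_inj (by finiteness)).1 h
    · rw [ENNReal.ofReal_of_nonpos (sub_nonpos.2 hab), zero_mul, mul_zero, add_zero]
      rw [show A n = (A n - B n) + B n by ring, ENNReal.ofReal_add (sub_nonneg.2 hab) (hB0 n),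
        add_mul, mul_add, add_right_comm] at h
      exact (ENNReal.add_left_inj (by finiteness)).1 h
  have hl1 : Tendsto (fun n => ENNReal.ofReal (A n - B n)) atTop (𝓝 (ENNReal.ofReal c)) :=
    ENNReal.tendsto_ofReal hlim
  have hl2 : Tendsto (fun n => ENNReal.ofReal (B n - A n)) atTop (𝓝 0) := by
    have := ENNReal.tendsto_ofReal hlim.neg
    rw [ENNReal.ofReal_of_nonpos (neg_nonpos.2 hc)] at this
    simpa [neg_sub] using this
  have hL := (tendsto_lintegral_truncKernel hα hα2 hS hSd).add
    (ENNReal.Tendsto.const_mul (a := 2) (ENNReal.Tendsto.mul_const hl2 (Or.inr hP))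
      (Or.inr (by simp)))
  have hR := (ENNReal.Tendsto.const_mul (a := 2) (ENNReal.Tendsto.mul_const hl1 (Or.inr hP))
      (Or.inr (by simp))).add (tendsto_lintegral_truncKernel hα hα2 hT hTd)
  rw [zero_mul, mul_zero, add_zero] at hL
  exact tendsto_nhds_unique hL (hR.congr fun n => (hid n).symm)

end Identity

/-! ### The energy of a Gaussian against a power -/

theorem lintegral_lintegral_lintegral_comm {X Y Z : Type*} [MeasurableSpace X]
    [MeasurableSpace Y] [MeasurableSpace Z] {μ : Measure X} {ν : Measure Y} {ρ : Measure Z}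
    [SFinite μ] [SFinite ν] [SFinite ρ] {g : X → Y → Z → ℝ≥0∞}
    (hg : Measurable fun p : X × Y × Z => g p.1 p.2.1 p.2.2) :
    ∫⁻ x, ∫⁻ y, ∫⁻ z, g x y z ∂ρ ∂ν ∂μ = ∫⁻ z, ∫⁻ x, ∫⁻ y, g x y z ∂ν ∂μ ∂ρ := by
  have h1 : Measurable (Function.uncurry fun x z => ∫⁻ y, g x y z ∂ν) := by
    have : Measurable fun p : (X × Z) × Y => g p.1.1 p.2 p.1.2 :=
      hg.comp (g := fun p : X × Y × Z => g p.1 p.2.1 p.2.2)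
        (f := fun p : (X × Z) × Y => (p.1.1, p.2, p.1.2)) (by fun_prop)
    exact this.lintegral_prod_right'
  rw [← lintegral_lintegral_swap h1.aemeasurable]
  refine lintegral_congr fun x => lintegral_lintegral_swap ?_
  exact (hg.comp (g := fun p : X × Y × Z => g p.1 p.2.1 p.2.2)
        (f := fun p : Y × Z => (x, p.1, p.2)) (by fun_prop)).aemeasurable

/-- The difference of powers is written as a Gamma integral in a further variable `z`; the
`t`-integral is then a Gamma integral and the `z`-integral a Mellin transform of
`1 - exp (-B z)`. -/
theorem lintegral_rpow_mul_rpow_sub {p q A B : ℝ} (hp : 0 < p) (hp1 : p < 1) (hq : 0 < q)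
    (hA : 0 < A) (hB : 0 < B) :
    ∫⁻ t in Ioi (0 : ℝ), ENNReal.ofReal (t ^ (p + q - 1) * ((A * t) ^ (-q) - (B + A * t) ^ (-q)))
      = ENNReal.ofReal (Real.Gamma (p + q) / Real.Gamma q * A ^ (-(p + q)) *
          (Real.Gamma (1 - p) / p * B ^ p)) := by
  have hGq := Real.Gamma_pos_of_pos hq
  have hGpq := Real.Gamma_pos_of_pos (add_pos hp hq)
  have hexp : ∀ {z : ℝ}, 0 < z → 0 ≤ 1 - Real.exp (-(B * z)) := fun hz =>
    sub_nonneg.2 (Real.exp_le_one_iff.2 (by nlinarith))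
  calc ∫⁻ t in Ioi (0 : ℝ),
        ENNReal.ofReal (t ^ (p + q - 1) * ((A * t) ^ (-q) - (B + A * t) ^ (-q)))
      = ∫⁻ t in Ioi (0 : ℝ), ∫⁻ z in Ioi (0 : ℝ), ENNReal.ofReal (t ^ (p + q - 1)) *
          (ENNReal.ofReal (Real.Gamma q)⁻¹ * ENNReal.ofReal (z ^ (q - 1) *
            (Real.exp (-(A * t * z)) - Real.exp (-((B + A * t) * z))))) := by
        refine setLIntegral_congr_fun measurableSet_Ioi fun t ht => ?_
        have ht' : (0 : ℝ) < t := ht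
        rw [lintegral_const_mul _ (by fun_prop), lintegral_const_mul _ (by fun_prop),
          lintegral_rpow_mul_exp_sub hq (by positivity) (by linarith),
          ← ENNReal.ofReal_mul (by positivity), ← ENNReal.ofReal_mul (by positivity)]
        congr 1; field_simp
    _ = ∫⁻ z in Ioi (0 : ℝ), ∫⁻ t in Ioi (0 : ℝ), ENNReal.ofReal (t ^ (p + q - 1)) *
          (ENNReal.ofReal (Real.Gamma q)⁻¹ * ENNReal.ofReal (z ^ (q - 1) *
            (Real.exp (-(A * t * z)) - Real.exp (-((B + A * t) * z))))) := by
        rw [lintegral_lintegral_swap]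
        exact Measurable.aemeasurable (by fun_prop)
    _ = ∫⁻ z in Ioi (0 : ℝ),
          ENNReal.ofReal (Real.Gamma (p + q) / Real.Gamma q * A ^ (-(p + q))) *
          ENNReal.ofReal (z ^ (-p - 1) * (1 - Real.exp (-(B * z)))) := by
        refine setLIntegral_congr_fun measurableSet_Ioi fun z hz => ?_
        have hz' : (0 : ℝ) < z := hz
        have hz2 := hexp hz'
        have : ∀ t ∈ Ioi (0 : ℝ), ENNReal.ofReal (t ^ (p + q - 1)) *
            (ENNReal.ofReal (Real.Gamma q)⁻¹ * ENNReal.ofReal (z ^ (q - 1) *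
            (Real.exp (-(A * t * z)) - Real.exp (-((B + A * t) * z))))) =
            ENNReal.ofReal ((Real.Gamma q)⁻¹ * z ^ (q - 1) * (1 - Real.exp (-(B * z)))) *
              ENNReal.ofReal (t ^ (p + q - 1) * Real.exp (-(A * z * t))) := fun t ht => by
          have ht' : (0 : ℝ) < t := ht
          rw [← ENNReal.ofReal_mul (by positivity), ← ENNReal.ofReal_mul (by positivity),
            ← ENNReal.ofReal_mul (by positivity),
            show -((B + A * t) * z) = -(B * z) + -(A * z * t) by ring,
            show -(A * t * z) = -(A * z * t) by ring, Real.exp_add]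
          congr 1; ring
        rw [setLIntegral_congr_fun measurableSet_Ioi this, lintegral_const_mul _ (by fun_prop),
          lintegral_rpow_mul_exp (add_pos hp hq) (by positivity),
          ← ENNReal.ofReal_mul (by positivity), ← ENNReal.ofReal_mul (by positivity),
          Real.mul_rpow hA.le hz'.le]
        congr 1
        have : z ^ (-p - 1) = z ^ (q - 1) * z ^ (-(p + q)) := by
          rw [← Real.rpow_add hz']; congr 1; ring
        rw [this]; ring
    _ = _ := by
        rw [lintegral_const_mul _ (by fun_prop), lintegral_rpow_mul_one_sub_exp hp hp1 hB,
          ← ENNReal.ofReal_mul (by positivity)]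

theorem lintegral_exp_sub_mul_exp_sub {p a A B : ℝ} (hp : 0 < p) (ha : 0 < a) (hA : 0 < A)
    (hB : 0 < B) :
    ∫⁻ s in Ioi (0 : ℝ), ENNReal.ofReal (s ^ (p - 1) *
        ((Real.exp (-(a * A)) - Real.exp (-(a * B))) *
          (Real.exp (-(s * A)) - Real.exp (-(s * B)))))
      = ENNReal.ofReal (Real.Gamma p *
          ((Real.exp (-(a * A)) - Real.exp (-(a * B))) * (A ^ (-p) - B ^ (-p)))) := by
  wlog hAB : A ≤ B generalizing A B
  · have e : ∀ r q u v : ℝ, (r - q) * (u - v) = (q - r) * (v - u) := by intros; ring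
    simp_rw [e (Real.exp (-(a * A))) (Real.exp (-(a * B)))]
    exact this hB hA (le_of_not_ge hAB)
  have h0 : 0 ≤ Real.exp (-(a * A)) - Real.exp (-(a * B)) :=
    sub_nonneg.2 (Real.exp_le_exp.2 (by nlinarith))
  have : ∀ s : ℝ, ENNReal.ofReal (s ^ (p - 1) *
        ((Real.exp (-(a * A)) - Real.exp (-(a * B))) *
          (Real.exp (-(s * A)) - Real.exp (-(s * B))))) =
      ENNReal.ofReal (Real.exp (-(a * A)) - Real.exp (-(a * B))) *
        ENNReal.ofReal (s ^ (p - 1) * (Real.exp (-(A * s)) - Real.exp (-(B * s)))) := fun s => by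
    rw [← ENNReal.ofReal_mul h0, mul_comm A, mul_comm B]
    congr 1; ring
  simp_rw [this]
  rw [lintegral_const_mul _ (by fun_prop), lintegral_rpow_mul_exp_sub hp hA hAB,
    ← ENNReal.ofReal_mul h0]
  congr 1; ring

theorem exp_sub_mul_rpow_sub_nonneg {a p A B : ℝ} (ha : 0 ≤ a) (hp : 0 ≤ p) (hA : 0 < A)
    (hB : 0 < B) :
    0 ≤ (Real.exp (-(a * A)) - Real.exp (-(a * B))) * (A ^ (-p) - B ^ (-p)) := by
  rcases le_total A B with h | h
  · exact mul_nonneg (sub_nonneg.2 (Real.exp_le_exp.2 (by nlinarith)))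
      (sub_nonneg.2 (Real.rpow_le_rpow_of_nonpos hA h (by linarith)))
  · exact mul_nonneg_of_nonpos_of_nonpos (sub_nonpos.2 (Real.exp_le_exp.2 (by nlinarith)))
      (sub_nonpos.2 (Real.rpow_le_rpow_of_nonpos hB h (by linarith)))

section GaussianEnergy

variable {d : ℕ} {α : ℝ}

/-- The bilinear energy `½ ∫∫ (φ(x) - φ(y)) (|x|^{-γ} - |y|^{-γ}) ν(x,y) dy dx` of the Gaussian
`φ(x) = exp (-|x|²)` and a power, in closed form. -/
noncomputable def gaussianEnergyConst (d : ℕ) (α γ : ℝ) : ℝ :=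
  2 ^ α * Real.pi ^ ((d : ℝ) / 2) * Real.Gamma ((γ + α) / 2) * Real.Gamma ((d - γ) / 2) /
    (Real.Gamma (γ / 2) * Real.Gamma ((d : ℝ) / 2))

/-- The functional equation of `Γ` at `-α / 2 ∈ (-1, 0)`, where `Γ` is negative. -/
theorem abs_Gamma_neg_half (hα : 0 < α) (hα2 : α < 2) :
    |Real.Gamma (-α / 2)| = Real.Gamma (1 - α / 2) / (α / 2) := by
  have h := Real.Gamma_add_one (s := -α / 2) (by linarith)
  have h1 : 0 < Real.Gamma (1 - α / 2) := Real.Gamma_pos_of_pos (by linarith)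
  rw [show -α / 2 + 1 = 1 - α / 2 by ring] at h
  have h2 : Real.Gamma (-α / 2) < 0 := by
    by_contra! h3
    nlinarith
  rw [abs_of_neg h2, h]
  field_simp

/-- The bilinear energy of `exp (-a |x|²)` and `|x|^{-γ}`: both the power and the kernel are
superpositions of Gaussians. -/
theorem lintegral_gaussian_rpow_energy (hα : 0 < α) (hα2 : α < 2) {γ : ℝ} (hγ : 0 < γ)
    (hγd : γ < d) {a : ℝ} (ha : 0 < a) :
    ∫⁻ x : EuclideanSpace ℝ (Fin d), ∫⁻ y : EuclideanSpace ℝ (Fin d), ENNReal.ofReal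
        ((Real.exp (-(a * ‖x‖ ^ 2)) - Real.exp (-(a * ‖y‖ ^ 2))) *
          (‖x‖ ^ (-γ) - ‖y‖ ^ (-γ)) * nu d α x y)
      = ENNReal.ofReal (2 * gaussianEnergyConst d α γ * a ^ ((γ + α - d) / 2)) := by
  have hd' : (0 : ℝ) < d := hγ.trans hγd
  have hd : 0 < d := by exact_mod_cast hd'
  have hfr : (Module.finrank ℝ (EuclideanSpace ℝ (Fin d)) : ℝ) = d := by simp
  have hN : 0 < normConst d α := normConst_pos hα hα2
  have hG1 := Real.Gamma_pos_of_pos (half_pos hγ)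
  have hG2 := Real.Gamma_pos_of_pos (by positivity : 0 < α / 2 + (d : ℝ) / 2)
  have hG3 := Real.Gamma_pos_of_pos (half_pos hd')
  have hG4 : 0 < Real.Gamma (1 - α / 2) := Real.Gamma_pos_of_pos (by linarith)
  set c : ℝ := normConst d α * (Real.Gamma (γ / 2))⁻¹ * (Real.Gamma (α / 2 + d / 2))⁻¹ with hc
  have hc0 : 0 < c := by positivity
  set G : EuclideanSpace ℝ (Fin d) → EuclideanSpace ℝ (Fin d) → ℝ → ℝ → ℝ := fun x y s t =>
    (Real.exp (-(a * ‖x‖ ^ 2)) - Real.exp (-(a * ‖y‖ ^ 2))) *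
      (Real.exp (-(s * ‖x‖ ^ 2)) - Real.exp (-(s * ‖y‖ ^ 2))) *
      Real.exp (-(t * ‖y - x‖ ^ 2)) with hG
  set f : EuclideanSpace ℝ (Fin d) → EuclideanSpace ℝ (Fin d) → ℝ → ℝ → ℝ≥0∞ := fun x y s t =>
    ENNReal.ofReal (c * s ^ (γ / 2 - 1) * t ^ (α / 2 + d / 2 - 1)) * ENNReal.ofReal (G x y s t)
    with hf
  have hfm : Measurable fun p : EuclideanSpace ℝ (Fin d) × EuclideanSpace ℝ (Fin d) × ℝ × ℝ =>
      f p.1 p.2.1 p.2.2.1 p.2.2.2 := by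
    simp only [hf, hG]
    fun_prop
  have h0 := ae_ne_zero_of_finrank_pos (V := EuclideanSpace ℝ (Fin d)) (by simpa using hd)
  have hNT : Nontrivial (EuclideanSpace ℝ (Fin d)) :=
    Module.finrank_pos_iff.1 (by simpa using hd : 0 < Module.finrank ℝ (EuclideanSpace ℝ (Fin d)))
  have hne : ∀ x : EuclideanSpace ℝ (Fin d), ∀ᵐ y, y ≠ x := fun x => by
    simp [ae_iff, measure_singleton]
  calc _ = ∫⁻ x : EuclideanSpace ℝ (Fin d), ∫⁻ y : EuclideanSpace ℝ (Fin d),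
        ∫⁻ s in Ioi (0 : ℝ), ∫⁻ t in Ioi (0 : ℝ), f x y s t := by
        refine lintegral_congr_ae ?_
        filter_upwards [h0] with x hx
        refine lintegral_congr_ae ?_
        filter_upwards [h0, hne x] with y hy hyx
        have hX : 0 < ‖x‖ ^ 2 := by positivity
        have hY : 0 < ‖y‖ ^ 2 := by positivity
        have hXY : 0 < ‖y - x‖ ^ 2 := by
          have := norm_pos_iff.2 (sub_ne_zero.2 hyx)
          positivity
        have hin : ∀ s ∈ Ioi (0 : ℝ), ∫⁻ t in Ioi (0 : ℝ), f x y s t =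
            ENNReal.ofReal (normConst d α * (Real.Gamma (γ / 2))⁻¹ * ‖y - x‖ ^ (-(d : ℝ) - α)) *
            ENNReal.ofReal (s ^ (γ / 2 - 1) *
              ((Real.exp (-(a * ‖x‖ ^ 2)) - Real.exp (-(a * ‖y‖ ^ 2))) *
              (Real.exp (-(s * ‖x‖ ^ 2)) - Real.exp (-(s * ‖y‖ ^ 2))))) := fun s hs => by
          have hs' : (0 : ℝ) < s := hs
          have hpos := exp_sub_mul_exp_sub_nonneg ha.le hs'.le (‖x‖ ^ 2) (‖y‖ ^ 2)
          have : ∀ t ∈ Ioi (0 : ℝ), f x y s t = ENNReal.ofReal (c * s ^ (γ / 2 - 1) *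
              ((Real.exp (-(a * ‖x‖ ^ 2)) - Real.exp (-(a * ‖y‖ ^ 2))) *
              (Real.exp (-(s * ‖x‖ ^ 2)) - Real.exp (-(s * ‖y‖ ^ 2))))) *
              ENNReal.ofReal (t ^ (α / 2 + d / 2 - 1) * Real.exp (-(‖y - x‖ ^ 2 * t))) :=
            fun t ht => by
              have ht' : (0 : ℝ) < t := ht
              simp only [hf, hG]
              rw [← ENNReal.ofReal_mul (by positivity), ← ENNReal.ofReal_mul (by positivity),
                mul_comm (‖y - x‖ ^ 2) t]
              congr 1; ring
          rw [setLIntegral_congr_fun measurableSet_Ioi this, lintegral_const_mul _ (by fun_prop),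
            lintegral_rpow_mul_exp (by positivity) hXY, ← ENNReal.ofReal_mul (by positivity),
            ← ENNReal.ofReal_mul (by positivity),
            show -(α / 2 + (d : ℝ) / 2) = -((d + α) / 2) by ring,
            sq_rpow_neg_half (norm_nonneg _), show -(d + α : ℝ) = -(d : ℝ) - α by ring]
          congr 1
          rw [hc]; field_simp
        rw [setLIntegral_congr_fun measurableSet_Ioi hin, lintegral_const_mul _ (by fun_prop),
          lintegral_exp_sub_mul_exp_sub (half_pos hγ) ha hX hY,
          ← ENNReal.ofReal_mul (by positivity), sq_rpow_neg_half (norm_nonneg _),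
          sq_rpow_neg_half (norm_nonneg _), nu]
        congr 1; field_simp
    _ = ∫⁻ s in Ioi (0 : ℝ), ∫⁻ t in Ioi (0 : ℝ), ∫⁻ x : EuclideanSpace ℝ (Fin d),
          ∫⁻ y : EuclideanSpace ℝ (Fin d), f x y s t := by
        rw [lintegral_lintegral_lintegral_comm]
        · refine lintegral_congr fun s => ?_
          rw [lintegral_lintegral_lintegral_comm]
          exact hfm.comp (g := fun p : EuclideanSpace ℝ (Fin d) × EuclideanSpace ℝ (Fin d) × ℝ × ℝ
            => f p.1 p.2.1 p.2.2.1 p.2.2.2)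
            (f := fun p : EuclideanSpace ℝ (Fin d) × EuclideanSpace ℝ (Fin d) × ℝ =>
              (p.1, p.2.1, s, p.2.2)) (by fun_prop)
        · have : Measurable fun p : (EuclideanSpace ℝ (Fin d) × EuclideanSpace ℝ (Fin d) × ℝ) × ℝ =>
              f p.1.1 p.1.2.1 p.1.2.2 p.2 :=
            hfm.comp (g := fun p : EuclideanSpace ℝ (Fin d) × EuclideanSpace ℝ (Fin d) × ℝ × ℝ
              => f p.1 p.2.1 p.2.2.1 p.2.2.2)
              (f := fun p : (EuclideanSpace ℝ (Fin d) × EuclideanSpace ℝ (Fin d) × ℝ) × ℝ =>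
                (p.1.1, p.1.2.1, p.1.2.2, p.2)) (by fun_prop)
          exact this.lintegral_prod_right'
    _ = ∫⁻ s in Ioi (0 : ℝ), ENNReal.ofReal (2 * (c * Real.pi ^ (d : ℝ) *
          (Real.Gamma (α / 2 + d / 2) / Real.Gamma (d / 2)) * (Real.Gamma (1 - α / 2) / (α / 2)) *
          a ^ (α / 2))) *
          ENNReal.ofReal (s ^ ((γ + α) / 2 - 1) * (a + s) ^ (-((γ + α) / 2 + (d - γ) / 2))) := by
        refine setLIntegral_congr_fun measurableSet_Ioi fun s hs => ?_
        have hs' : (0 : ℝ) < s := hs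
        have : ∀ t ∈ Ioi (0 : ℝ), ∫⁻ x : EuclideanSpace ℝ (Fin d),
            ∫⁻ y : EuclideanSpace ℝ (Fin d), f x y s t =
            ENNReal.ofReal (2 * (c * s ^ (γ / 2 - 1) * Real.pi ^ (d : ℝ))) *
              ENNReal.ofReal (t ^ (α / 2 + d / 2 - 1) * (((a + s) * t) ^ (-((d : ℝ) / 2)) -
                (a * s + (a + s) * t) ^ (-((d : ℝ) / 2)))) := fun t ht => by
          have ht' : (0 : ℝ) < t := ht
          have hm : ∀ x, Measurable fun y => ENNReal.ofReal (G x y s t) := fun x => by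
            simp only [hG]; fun_prop
          have hm2 : Measurable fun x => ∫⁻ y, ENNReal.ofReal (G x y s t) := by
            have : Measurable (Function.uncurry fun x y => ENNReal.ofReal (G x y s t)) := by
              simp only [hG]; fun_prop
            exact this.lintegral_prod_right'
          simp only [hf]
          simp_rw [fun x => lintegral_const_mul (μ := volume)
            (ENNReal.ofReal (c * s ^ (γ / 2 - 1) * t ^ (α / 2 + d / 2 - 1))) (hm x)]
          rw [lintegral_const_mul _ hm2, lintegral_gaussian_energy ha hs' ht', hfr,
            ← ENNReal.ofReal_ofNat 2, ← ENNReal.ofReal_mul (by positivity),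
            ← ENNReal.ofReal_mul (by positivity), ← ENNReal.ofReal_mul (by positivity)]
          congr 1; ring
        rw [setLIntegral_congr_fun measurableSet_Ioi this, lintegral_const_mul _ (by fun_prop),
          lintegral_rpow_mul_rpow_sub (half_pos hα) (by linarith) (half_pos hd') (by positivity)
            (by positivity),
          ← ENNReal.ofReal_mul (by positivity), ← ENNReal.ofReal_mul (by positivity)]
        congr 1
        have : s ^ ((γ + α) / 2 - 1) = s ^ (γ / 2 - 1) * s ^ (α / 2) := by
          rw [← Real.rpow_add hs']; congr 1; ring
        rw [this, Real.mul_rpow ha.le hs'.le,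
          show (γ + α) / 2 + (d - γ) / 2 = α / 2 + (d : ℝ) / 2 by ring]
        ring
    _ = _ := by
        have hG5 : 0 < Real.Gamma ((γ + α) / 2) := Real.Gamma_pos_of_pos (by positivity)
        have hG6 : 0 < Real.Gamma ((d - γ) / 2) := Real.Gamma_pos_of_pos (by linarith)
        rw [lintegral_const_mul _ (by fun_prop), lintegral_rpow_mul_add_rpow (by positivity)
          (by linarith) ha, ← ENNReal.ofReal_mul (by positivity),
          show (γ + α) / 2 + (d - γ) / 2 = α / 2 + (d : ℝ) / 2 by ring]
        congr 1
        have h1 : a ^ ((γ + α - d) / 2) = a ^ (α / 2) * a ^ (-((d - γ) / 2)) := by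
          rw [← Real.rpow_add ha]; congr 1; ring
        have h2 : Real.pi ^ (d : ℝ) = Real.pi ^ ((d : ℝ) / 2) * Real.pi ^ ((d : ℝ) / 2) := by
          rw [← Real.rpow_add Real.pi_pos]; congr 1; ring
        have h3 : Real.pi ^ (-(d : ℝ) / 2) = (Real.pi ^ ((d : ℝ) / 2))⁻¹ := by
          rw [← Real.rpow_neg Real.pi_pos.le]; congr 1; ring
        rw [h1, h2, hc, gaussianEnergyConst, normConst, h3, abs_Gamma_neg_half hα hα2,
          show ((d : ℝ) + α) / 2 = α / 2 + (d : ℝ) / 2 by ring]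
        generalize Real.Gamma (1 - α / 2) = g at *
        field_simp

end GaussianEnergy

/-! ### The Hardy constant and the ground state representation -/

section HardyConst

variable {d : ℕ} {α β : ℝ}

theorem hardyConst_nonneg (hα : 0 < α) (hβ : 0 ≤ β) (hβ' : α * (β + 1) ≤ d) :
    0 ≤ hardyConst d α β := by
  have h1 : 0 ≤ α * β := by positivity
  have h2 := Real.Gamma_nonneg_of_nonneg (by linarith : 0 ≤ (d : ℝ) / 2 - α * β / 2)
  have h3 := Real.Gamma_nonneg_of_nonneg (by positivity : 0 ≤ α * (β + 1) / 2)
  have h4 := Real.Gamma_nonneg_of_nonneg (by linarith : 0 ≤ (d : ℝ) / 2 - α * (β + 1) / 2)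
  have h5 := Real.Gamma_nonneg_of_nonneg (by positivity : 0 ≤ α * β / 2)
  unfold hardyConst
  positivity

theorem hardyConst_pos (hα : 0 < α) (hβ : 0 < β) (hβ' : α * (β + 1) < d) :
    0 < hardyConst d α β := by
  have h1 : 0 < α * β := by positivity
  have h2 := Real.Gamma_pos_of_pos (by linarith : 0 < (d : ℝ) / 2 - α * β / 2)
  have h3 := Real.Gamma_pos_of_pos (by positivity : 0 < α * (β + 1) / 2)
  have h4 := Real.Gamma_pos_of_pos (by linarith : 0 < (d : ℝ) / 2 - α * (β + 1) / 2)
  have h5 := Real.Gamma_pos_of_pos (by positivity : 0 < α * β / 2)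
  unfold hardyConst
  positivity

theorem hardyConst_zero : hardyConst d α 0 = 0 := by
  simp [hardyConst]

theorem one_sub_exp_neg_le_rpow {t p : ℝ} (ht : 0 ≤ t) (hp : 0 < p) (hp1 : p ≤ 1) :
    1 - Real.exp (-t) ≤ t ^ p := by
  rcases le_total t 1 with h | h
  · have h1 : t ≤ t ^ p := by
      rcases ht.eq_or_lt with rfl | ht
      · rw [Real.zero_rpow hp.ne']
      · simpa using Real.rpow_le_rpow_of_exponent_ge ht h hp1
    linarith [Real.add_one_le_exp (-t)]
  · linarith [Real.one_le_rpow h hp.le, Real.exp_pos (-t)]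

/-- The truncated constants converge to the Hardy constant. For `β > 0` the limit is read off from
the energy of `exp (-|x|²)` against the weight. For `β = 0` the Hardy integral of that pair
diverges; the difference of `exp (-|x|²)` and `exp (-2 |x|²)` is used instead, and the two energies
coincide by scaling. -/
theorem tendsto_truncCoeff_sub_hardyConst (hα : 0 < α) (hα2 : α < 2) (hβ : 0 ≤ β)
    (hβ' : α * (β + 1) < d) {e : EuclideanSpace ℝ (Fin d)} (he : ‖e‖ = 1) :
    Tendsto (fun n => (truncCoeff d α 0 n e).toReal -
      (truncCoeff d α (d - α * (β + 1)) n e).toReal) atTop (𝓝 (hardyConst d α β)) := by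
  set γ : ℝ := d - α * (β + 1) with hγdef
  have hαβ : 0 ≤ α * β := by positivity
  have hγ : 0 < γ := by linarith
  have hγd : γ < d := by linarith
  have hd0 : (0 : ℝ) < d := hγ.trans hγd
  have hd : 0 < d := by exact_mod_cast hd0
  set S : ℝ → EuclideanSpace ℝ (Fin d) → EuclideanSpace ℝ (Fin d) → ℝ := fun a x y =>
    (Real.exp (-(a * ‖x‖ ^ 2)) - Real.exp (-(a * ‖y‖ ^ 2))) * (‖x‖ ^ (-γ) - ‖y‖ ^ (-γ)) with hS
  have hSm : ∀ a, Measurable (Function.uncurry (S a)) := fun a => by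
    simp only [hS]; fun_prop
  have hSd : ∀ a x, S a x x = 0 := fun a x => by simp [hS]
  have hS0 : ∀ a, 0 < a → ∀ x y, x ≠ 0 → y ≠ 0 → 0 ≤ S a x y := fun a ha x y hx hy => by
    have := exp_sub_mul_rpow_sub_nonneg (A := ‖x‖ ^ 2) (B := ‖y‖ ^ 2) ha.le (half_pos hγ).le
      (by positivity) (by positivity)
    rwa [sq_rpow_neg_half (norm_nonneg _), sq_rpow_neg_half (norm_nonneg _)] at this
  have hquot : ∀ {x y : EuclideanSpace ℝ (Fin d)}, x ≠ 0 → y ≠ 0 →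
      ‖x‖ ^ (-γ) * (‖y‖ / ‖x‖) ^ (-γ) = ‖y‖ ^ (-γ) := fun {x y} hx hy => by
    rw [← Real.mul_rpow (norm_nonneg _) (by positivity), mul_div_cancel₀]
    exact norm_ne_zero_iff.2 hx
  have hE : ∀ a, 0 < a → ∫⁻ x, ∫⁻ y, ENNReal.ofReal (S a x y * nu d α x y) =
      ENNReal.ofReal (2 * gaussianEnergyConst d α γ * a ^ ((γ + α - d) / 2)) := fun a ha =>
    lintegral_gaussian_rpow_energy hα hα2 hγ hγd ha
  have hG1 := Real.Gamma_pos_of_pos (by positivity : 0 < (γ + α) / 2)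
  have hG2 := Real.Gamma_pos_of_pos (by linarith : 0 < (d - γ) / 2)
  have hG3 := Real.Gamma_pos_of_pos (by positivity : 0 < γ / 2)
  have hG4 := Real.Gamma_pos_of_pos (by positivity : 0 < (d : ℝ) / 2)
  have hgc : 0 < gaussianEnergyConst d α γ := by unfold gaussianEnergyConst; positivity
  rcases hβ.eq_or_lt with hβ0 | hβ0
  · have hγα : γ + α = d := by rw [hγdef, ← hβ0]; ring
    have hE' : ∀ a, 0 < a → ∫⁻ x, ∫⁻ y, ENNReal.ofReal (S a x y * nu d α x y) =
        ENNReal.ofReal (2 * gaussianEnergyConst d α γ) := fun a ha => by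
      rw [hE a ha, hγα, sub_self, zero_div, Real.rpow_zero, mul_one]
    set F : EuclideanSpace ℝ (Fin d) → ℝ := fun x =>
      (Real.exp (-(1 * ‖x‖ ^ 2)) - Real.exp (-(2 * ‖x‖ ^ 2))) * ‖x‖ ^ (-γ) with hF
    have hψ : ∀ x : EuclideanSpace ℝ (Fin d),
        0 ≤ Real.exp (-(1 * ‖x‖ ^ 2)) - Real.exp (-(2 * ‖x‖ ^ 2)) := fun x =>
      sub_nonneg.2 (Real.exp_le_exp.2 (by nlinarith [sq_nonneg ‖x‖]))
    have hP : ∫⁻ x, ENNReal.ofReal (F x * ‖x‖ ^ (-α)) ≠ ⊤ := by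
      refine ((lintegral_mono fun x => ENNReal.ofReal_le_ofReal ?_).trans_lt
        (lintegral_gaussian_mul_rpow_lt_top (V := EuclideanSpace ℝ (Fin d)) (δ := γ) hγ.le
          (by simpa using hγd))).ne
      have h1 : Real.exp (-(1 * ‖x‖ ^ 2)) - Real.exp (-(2 * ‖x‖ ^ 2)) ≤
          Real.exp (-‖x‖ ^ 2) * ‖x‖ ^ α := by
        have h2 := one_sub_exp_neg_le_rpow (sq_nonneg ‖x‖) (half_pos hα) (by linarith)
        rw [← Real.rpow_two, ← Real.rpow_mul (norm_nonneg _), mul_div_cancel₀ _ two_ne_zero,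
          Real.rpow_two] at h2
        calc _ = Real.exp (-‖x‖ ^ 2) * (1 - Real.exp (-‖x‖ ^ 2)) := by
              rw [show -(2 * ‖x‖ ^ 2) = -‖x‖ ^ 2 + -‖x‖ ^ 2 by ring, Real.exp_add, one_mul]
              ring
          _ ≤ _ := by gcongr
      have h3 : ‖x‖ ^ α * ‖x‖ ^ (-α) ≤ 1 := by
        rcases eq_or_ne x 0 with rfl | hx
        · simp [Real.zero_rpow hα.ne']
        · rw [← Real.rpow_add (norm_pos_iff.2 hx), add_neg_cancel, Real.rpow_zero]
      calc F x * ‖x‖ ^ (-α) ≤ (Real.exp (-‖x‖ ^ 2) * ‖x‖ ^ α) * ‖x‖ ^ (-γ) * ‖x‖ ^ (-α) := by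
            simp only [hF]; gcongr
        _ = Real.exp (-‖x‖ ^ 2) * ‖x‖ ^ (-γ) * (‖x‖ ^ α * ‖x‖ ^ (-α)) := by ring
        _ ≤ _ := mul_le_of_le_one_right (by positivity) h3
    have hP0 : ∫⁻ x, ENNReal.ofReal (F x * ‖x‖ ^ (-α)) ≠ 0 := by
      intro h0
      rw [lintegral_eq_zero_iff (by simp only [hF]; fun_prop)] at h0
      have : ∀ᵐ x : EuclideanSpace ℝ (Fin d), False := by
        filter_upwards [h0, ae_ne_zero_of_finrank_pos (V := EuclideanSpace ℝ (Fin d))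
          (by simpa using hd)] with x hx hx0
        have hx' : 0 < ‖x‖ := norm_pos_iff.2 hx0
        have h1 : 0 < Real.exp (-(1 * ‖x‖ ^ 2)) - Real.exp (-(2 * ‖x‖ ^ 2)) :=
          sub_pos.2 (Real.exp_lt_exp.2 (by nlinarith))
        have h2 : 0 < F x * ‖x‖ ^ (-α) := by simp only [hF]; positivity
        simp only [Pi.zero_apply, ENNReal.ofReal_eq_zero] at hx
        linarith
      exact this.exists.elim fun _ h => h
    have := tendsto_truncCoeff_sub hα hα2 hγ.le hγd he (F := F) (by simp only [hF]; fun_prop)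
      (fun x => mul_nonneg (hψ x) (by positivity)) (hSm 1) (hSm 2) (hS0 1 one_pos)
      (hS0 2 two_pos) (hSd 1) (hSd 2) (fun x y hx hy => ?_) hP hP0
      (by rw [hE' 1 one_pos]; exact ENNReal.ofReal_ne_top)
      (by rw [hE' 2 two_pos]; exact ENNReal.ofReal_ne_top)
    · rw [← hβ0, hardyConst_zero]
      rwa [hE' 1 one_pos, hE' 2 two_pos, sub_self, zero_div] at this
    · simp only [hF, hS]
      rw [mul_assoc, mul_assoc, hquot hx hy, hquot hy hx]
      ring
  · have hδ : γ + α < d := by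
      have : 0 < α * β := by positivity
      linarith
    set F : EuclideanSpace ℝ (Fin d) → ℝ := fun x =>
      Real.exp (-(1 * ‖x‖ ^ 2)) * ‖x‖ ^ (-γ) with hF
    have hG5 := Real.Gamma_pos_of_pos (by linarith : 0 < (d - (γ + α)) / 2)
    have hP : ∫⁻ x, ENNReal.ofReal (F x * ‖x‖ ^ (-α)) =
        ENNReal.ofReal (Real.pi ^ ((d : ℝ) / 2) *
          (Real.Gamma ((d - (γ + α)) / 2) / Real.Gamma ((d : ℝ) / 2))) := by
      have := lintegral_gaussian_mul_rpow (V := EuclideanSpace ℝ (Fin d)) (δ := γ + α)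
        (by positivity) (by simpa using hδ)
      simp only [finrank_euclideanSpace_fin] at this
      rw [← this]
      refine lintegral_congr_ae ?_
      filter_upwards [ae_ne_zero_of_finrank_pos (V := EuclideanSpace ℝ (Fin d))
        (by simpa using hd)] with x hx
      simp only [hF]
      rw [neg_add, Real.rpow_add (norm_pos_iff.2 hx), one_mul, mul_assoc]
    have := tendsto_truncCoeff_sub hα hα2 hγ.le hγd he (F := F) (T := fun _ _ => 0)
      (by simp only [hF]; fun_prop)
      (fun x => by simp only [hF]; positivity) (hSm 1) (by fun_prop) (hS0 1 one_pos)
      (fun _ _ _ _ => le_rfl) (hSd 1) (fun _ => rfl) (fun x y hx hy => ?_)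
      (by rw [hP]; exact ENNReal.ofReal_ne_top)
      (by rw [hP]; exact (ENNReal.ofReal_pos.2 (by positivity)).ne')
      (by rw [hE 1 one_pos]; exact ENNReal.ofReal_ne_top) (by simp)
    · rw [hE 1 one_pos, hP, ENNReal.toReal_ofReal (by positivity),
        ENNReal.toReal_ofReal (by positivity)] at this
      convert this using 2
      simp only [zero_mul, ENNReal.ofReal_zero, lintegral_zero, ENNReal.toReal_zero, sub_zero,
        Real.one_rpow, mul_one, gaussianEnergyConst, hardyConst]
      rw [show (d : ℝ) / 2 - α * β / 2 = (γ + α) / 2 by rw [hγdef]; ring,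
        show α * (β + 1) / 2 = (d - γ) / 2 by rw [hγdef]; ring,
        show (d : ℝ) / 2 - (d - γ) / 2 = γ / 2 by ring,
        show α * β / 2 = (d - (γ + α)) / 2 by rw [hγdef]; ring]
      field_simp
    · simp only [hF, hS]
      rw [mul_assoc, mul_assoc, hquot hx hy, hquot hy hx]
      ring

theorem weight_eq (x : EuclideanSpace ℝ (Fin d)) :
    weight d α β x = ‖x‖ ^ (-(d - α * (β + 1))) := by
  rw [weight, neg_sub]

@[fun_prop]
theorem measurable_weight : Measurable (weight d α β) := by
  unfold weight
  fun_prop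

theorem weight_pos {x : EuclideanSpace ℝ (Fin d)} (hx : x ≠ 0) : 0 < weight d α β x :=
  Real.rpow_pos_of_pos (norm_pos_iff.2 hx) _

theorem exists_norm_eq_one (hd : 0 < d) : ∃ e : EuclideanSpace ℝ (Fin d), ‖e‖ = 1 :=
  ⟨EuclideanSpace.single ⟨0, hd⟩ 1, by simp⟩

theorem hardyIntegral_eq (u : EuclideanSpace ℝ (Fin d) → ℝ) :
    hardyIntegral d α u = ∫⁻ x, ENNReal.ofReal (u x ^ 2 * ‖x‖ ^ (-α)) := by
  unfold hardyIntegral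
  simp_rw [fun x : EuclideanSpace ℝ (Fin d) => Real.rpow_neg (norm_nonneg x) α, div_eq_mul_inv]

/-- The ground state representation for functions with a finite Hardy integral. -/
theorem dirichletForm_eq_of_hardyIntegral_lt_top (hα : 0 < α) (hα2 : α < 2) (hβ : 0 ≤ β)
    (hβ' : α * (β + 1) < d) {u : EuclideanSpace ℝ (Fin d) → ℝ} (hu : Measurable u)
    (hH : hardyIntegral d α u < ⊤) :
    dirichletForm d α u =
      ENNReal.ofReal (hardyConst d α β) * hardyIntegral d α u + remainder d α β u := by
  have hd0 : (0 : ℝ) < d := lt_of_le_of_lt (by positivity) hβ'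
  have hd : 0 < d := by exact_mod_cast hd0
  obtain ⟨e, he⟩ := exists_norm_eq_one hd
  rw [hardyIntegral_eq] at hH ⊢
  have hαβ : 0 ≤ α * β := by positivity
  have hid := nu_identity hα hα2 (γ := d - α * (β + 1)) (by linarith) (by linarith) he
    (F := fun x => u x ^ 2) (by fun_prop) (fun x => sq_nonneg _)
    (S := fun x y => (u x - u y) ^ 2)
    (T := fun x y => (u x / weight d α β x - u y / weight d α β y) ^ 2
      * weight d α β x * weight d α β y)
    (by fun_prop) (by fun_prop) (fun _ _ _ _ => sq_nonneg _)
    (fun x y hx hy => mul_nonneg (mul_nonneg (sq_nonneg _) (weight_pos hx).le) (weight_pos hy).le)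
    (by simp) (by simp) (fun x y hx hy => ?_) hH.ne (hardyConst_nonneg hα hβ hβ'.le)
    (tendsto_truncCoeff_sub_hardyConst hα hα2 hβ hβ' he)
  · rw [dirichletForm, remainder, hid, mul_add, ← mul_assoc, one_div,
      ENNReal.inv_mul_cancel (by simp) (by simp), one_mul]
  · have hwx := weight_pos (α := α) (β := β) hx
    have hwy := weight_pos (α := α) (β := β) hy
    rw [Real.div_rpow (norm_nonneg _) (norm_nonneg _), Real.div_rpow (norm_nonneg _)
      (norm_nonneg _), ← weight_eq, ← weight_eq]
    field_simp
    ring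

end HardyConst

/-! ### The maximum of the Hardy constant -/

section Maximum

variable {d : ℕ} {α β : ℝ}

/-- The truncated coefficients are midpoint convex in the exponent, because `γ ↦ |y|^{-γ}` is. -/
theorem two_mul_truncCoeff_midpoint_le (hd : 0 < d) (γ γ' : ℝ) (n : ℕ)
    (e : EuclideanSpace ℝ (Fin d)) :
    2 * truncCoeff d α ((γ + γ') / 2) n e ≤ truncCoeff d α γ n e + truncCoeff d α γ' n e := by
  have hK : Measurable (truncKernel d α n e) := (measurable_truncKernel n).of_uncurry_left
  rw [truncCoeff, truncCoeff, truncCoeff, ← lintegral_const_mul _ (by fun_prop),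
    ← lintegral_add_left (by fun_prop)]
  refine lintegral_mono_ae ?_
  filter_upwards [ae_ne_zero_of_finrank_pos (V := EuclideanSpace ℝ (Fin d)) (by simpa using hd)]
    with y hy
  rw [mul_left_comm, ← mul_add]
  refine mul_le_mul_right ?_ _
  rw [two_mul, ← ENNReal.ofReal_add (by positivity) (by positivity),
    ← ENNReal.ofReal_add (by positivity) (by positivity)]
  refine ENNReal.ofReal_le_ofReal ?_
  have hy' : 0 < ‖y‖ := norm_pos_iff.2 hy
  have h : ∀ p : ℝ, ‖y‖ ^ (-p) = ‖y‖ ^ (-(p / 2)) * ‖y‖ ^ (-(p / 2)) := fun p => by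
    rw [← Real.rpow_add hy']; congr 1; ring
  have h2 : ‖y‖ ^ (-((γ + γ') / 2)) = ‖y‖ ^ (-(γ / 2)) * ‖y‖ ^ (-(γ' / 2)) := by
    rw [← Real.rpow_add hy']; congr 1; ring
  rw [h γ, h γ', h2]
  nlinarith [sq_nonneg (‖y‖ ^ (-(γ / 2)) - ‖y‖ ^ (-(γ' / 2)))]

theorem hardyConst_symm (hα : 0 < α) : hardyConst d α (d / α - 1 - β) = hardyConst d α β := by
  unfold hardyConst
  have h1 : α * (d / α - 1 - β) = d - α * (β + 1) := by field_simp; ring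
  have h2 : α * (d / α - 1 - β + 1) = d - α * β := by field_simp; ring
  rw [h1, h2, show (d : ℝ) / 2 - (d - α * (β + 1)) / 2 = α * (β + 1) / 2 by ring,
    show (d : ℝ) / 2 - (d - α * β) / 2 = α * β / 2 by ring,
    show ((d : ℝ) - α * β) / 2 = d / 2 - α * β / 2 by ring,
    show ((d : ℝ) - α * (β + 1)) / 2 = d / 2 - α * (β + 1) / 2 by ring]
  ring

theorem hardyConst_endpoint (hα : 0 < α) : hardyConst d α (d / α - 1) = 0 := by
  have := hardyConst_symm (d := d) (β := 0) hα
  rwa [sub_zero, hardyConst_zero] at this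

/-- The Hardy constant is concave as a limit of concave functions and symmetric, so it is largest
at the midpoint of its interval. -/
theorem hardyConst_le_midpoint (hα : 0 < α) (hα2 : α < 2) (hαd : α < d) (hβ : 0 ≤ β)
    (hβ' : β ≤ (d : ℝ) / α - 1) : hardyConst d α β ≤ hardyConst d α ((d - α) / (2 * α)) := by
  have hm0 : 0 < (d - α) / (2 * α) := div_pos (sub_pos.2 hαd) (by positivity)
  have hm1 : α * ((d - α) / (2 * α) + 1) = (d + α) / 2 := by field_simp; ring
  have hm2 : α * ((d - α) / (2 * α) + 1) < d := by rw [hm1]; linarith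
  have hpos := hardyConst_pos hα hm0 hm2
  rcases hβ.eq_or_lt with rfl | hβ0
  · rw [hardyConst_zero]; exact hpos.le
  rcases hβ'.eq_or_lt with rfl | hβ1
  · rw [hardyConst_endpoint hα]; exact hpos.le
  have hd0 : (0 : ℝ) < d := hα.trans hαd
  have hd : 0 < d := by exact_mod_cast hd0
  obtain ⟨e, he⟩ := exists_norm_eq_one hd
  have hβ2 : α * (β + 1) < d := by
    rwa [lt_sub_iff_add_lt, lt_div_iff₀ hα, mul_comm] at hβ1
  have hαβ : 0 < α * β := by positivity
  have hb1 : α * (d / α - 1 - β + 1) = d - α * β := by field_simp; ring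
  have hb2 : α * (d / α - 1 - β + 1) < d := by rw [hb1]; linarith
  have l1 := tendsto_truncCoeff_sub_hardyConst hα hα2 hβ hβ2 he
  have l2 := tendsto_truncCoeff_sub_hardyConst hα hα2 (by linarith : 0 ≤ (d : ℝ) / α - 1 - β)
    hb2 he
  have l3 := tendsto_truncCoeff_sub_hardyConst hα hα2 hm0.le hm2 he
  rw [hardyConst_symm hα, hb1] at l2
  rw [hm1] at l3
  have := le_of_tendsto_of_tendsto' (l1.add l2) (l3.const_mul 2) fun n => ?_
  · linarith
  · have f0 := truncCoeff_lt_top hα hα2 le_rfl hd0 n he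
    have f1 := truncCoeff_lt_top hα hα2 (γ := d - α * (β + 1)) (by linarith) (by linarith) n he
    have f2 := truncCoeff_lt_top hα hα2 (γ := d - (d - α * β)) (by linarith) (by linarith) n he
    have hc := two_mul_truncCoeff_midpoint_le (α := α) hd (d - α * (β + 1)) (d - (d - α * β)) n e
    rw [show (d - α * (β + 1) + (d - (d - α * β))) / 2 = d - (d + α) / 2 by ring] at hc
    have hc' := ENNReal.toReal_mono (by finiteness) hc
    rw [ENNReal.toReal_mul, ENNReal.toReal_add f1.ne f2.ne, ENNReal.toReal_ofNat] at hc'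
    linarith

theorem hardyConst_midpoint (hα : 0 < α) : hardyConst d α ((d - α) / (2 * α)) =
    2 ^ α * Real.Gamma ((d + α) / 4) ^ 2 * (Real.Gamma ((d - α) / 4) ^ 2)⁻¹ := by
  have h1 : α * ((d - α) / (2 * α)) = (d - α) / 2 := by field_simp
  have h2 : α * ((d - α) / (2 * α) + 1) = (d + α) / 2 := by field_simp; ring
  rw [hardyConst, h1, h2, show (d : ℝ) / 2 - (d - α) / 2 / 2 = (d + α) / 4 by ring,
    show (d + α) / 2 / 2 = (d + α) / 4 by ring,
    show (d : ℝ) / 2 - (d + α) / 4 = (d - α) / 4 by ring,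
    show (d - α) / 2 / 2 = (d - α) / 4 by ring]
  ring

end Maximum

/-! ### Functions of finite energy have a finite Hardy integral -/

section Hardy

variable {d : ℕ} {α : ℝ}

/-- The truncation of a real number to `[-m, m]`. -/
noncomputable def clamp (m : ℕ) (a : ℝ) : ℝ := max (-m) (min a m)

@[fun_prop]
theorem measurable_clamp (m : ℕ) : Measurable (clamp m) := by
  unfold clamp
  fun_prop

theorem abs_clamp_sub_clamp_le (m : ℕ) (a b : ℝ) : |clamp m a - clamp m b| ≤ |a - b| := by
  unfold clamp
  rw [max_comm _ (min a _), max_comm _ (min b _)]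
  refine (abs_max_sub_max_le_abs _ _ _).trans ?_
  simpa using abs_min_sub_min_le_max a (m : ℝ) b m

theorem abs_clamp (m : ℕ) (a : ℝ) : |clamp m a| = min |a| m := by
  have hm : (0 : ℝ) ≤ m := m.cast_nonneg
  unfold clamp
  rcases le_total 0 a with ha | ha
  · rw [max_eq_right (by have := le_min ha hm; linarith), abs_of_nonneg (le_min ha hm),
      abs_of_nonneg ha]
  · rw [min_eq_left (ha.trans hm), abs_of_nonpos ha, abs_of_nonpos (max_le (by linarith) ha),
      ← min_neg_neg, neg_neg, min_comm]

theorem dirichletForm_clamp_le (hα : 0 < α) (hα2 : α < 2) (m : ℕ)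
    (u : EuclideanSpace ℝ (Fin d) → ℝ) :
    dirichletForm d α (fun x => clamp m (u x)) ≤ dirichletForm d α u := by
  refine mul_le_mul_right (lintegral_mono fun x => lintegral_mono fun y =>
    ENNReal.ofReal_le_ofReal (mul_le_mul_of_nonneg_right ?_ (nu_nonneg hα hα2 x y))) _
  exact sq_le_sq.2 (abs_clamp_sub_clamp_le m _ _)

/-- The weight `|x|^{-α}` is integrable near the origin, since `α < d`, and bounded elsewhere. -/
theorem hardyIntegral_lt_top_of_bounded (hα : 0 < α) (hαd : α < d)
    {u : EuclideanSpace ℝ (Fin d) → ℝ} (hu : Measurable u)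
    (hL2 : ∫⁻ x, ENNReal.ofReal (u x ^ 2) < ⊤) {m : ℝ} (hm : ∀ x, |u x| ≤ m) :
    hardyIntegral d α u < ⊤ := by
  have hg := lintegral_gaussian_mul_rpow_lt_top (V := EuclideanSpace ℝ (Fin d)) hα.le
    (by simpa using hαd)
  rw [hardyIntegral_eq]
  have hle : ∀ x : EuclideanSpace ℝ (Fin d), ENNReal.ofReal (u x ^ 2 * ‖x‖ ^ (-α)) ≤
      ENNReal.ofReal (m ^ 2 * Real.exp 1) *
        ENNReal.ofReal (Real.exp (-‖x‖ ^ 2) * ‖x‖ ^ (-α)) + ENNReal.ofReal (u x ^ 2) := fun x => by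
    rw [← ENNReal.ofReal_mul (by positivity),
      ← ENNReal.ofReal_add (by positivity) (by positivity)]
    refine ENNReal.ofReal_le_ofReal ?_
    rcases le_total ‖x‖ 1 with hx | hx
    · have h1 : u x ^ 2 ≤ m ^ 2 := sq_le_sq' (abs_le.1 (hm x)).1 (abs_le.1 (hm x)).2
      have h2 : 1 ≤ Real.exp 1 * Real.exp (-‖x‖ ^ 2) := by
        rw [← Real.exp_add]
        exact Real.one_le_exp (by nlinarith [norm_nonneg x])
      calc u x ^ 2 * ‖x‖ ^ (-α)
          ≤ m ^ 2 * 1 * ‖x‖ ^ (-α) := by rw [mul_one]; gcongr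
        _ ≤ m ^ 2 * (Real.exp 1 * Real.exp (-‖x‖ ^ 2)) * ‖x‖ ^ (-α) := by gcongr
        _ = m ^ 2 * Real.exp 1 * (Real.exp (-‖x‖ ^ 2) * ‖x‖ ^ (-α)) := by ring
        _ ≤ _ := le_add_of_nonneg_right (sq_nonneg _)
    · refine le_trans ?_ (le_add_of_nonneg_left (by positivity))
      exact mul_le_of_le_one_right (sq_nonneg _)
        (Real.rpow_le_one_of_one_le_of_nonpos hx (by linarith))
  refine (lintegral_mono hle).trans_lt ?_
  rw [lintegral_add_right _ (by fun_prop), lintegral_const_mul _ (by fun_prop)]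
  finiteness

/-- Hardy's inequality for truncations of `u`, followed by monotone convergence. -/
theorem hardyIntegral_lt_top_of_dirichletForm (hα : 0 < α) (hα2 : α < 2) (hαd : α < d)
    {u : EuclideanSpace ℝ (Fin d) → ℝ} (hu : Measurable u)
    (hL2 : ∫⁻ x, ENNReal.ofReal (u x ^ 2) < ⊤) (hE : dirichletForm d α u < ⊤) :
    hardyIntegral d α u < ⊤ := by
  set C := hardyConst d α ((d - α) / (2 * α)) with hC
  have hm0 : 0 < (d - α) / (2 * α) := div_pos (sub_pos.2 hαd) (by positivity)
  have hm1 : α * ((d - α) / (2 * α) + 1) = (d + α) / 2 := by field_simp; ring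
  have hm2 : α * ((d - α) / (2 * α) + 1) < d := by rw [hm1]; linarith
  have hCpos : 0 < C := hardyConst_pos hα hm0 hm2
  have hsq : ∀ (m : ℕ) x, clamp m (u x) ^ 2 = min |u x| m ^ 2 := fun m x => by
    rw [← abs_clamp, sq_abs]
  have hle : ∀ m : ℕ, ENNReal.ofReal C * hardyIntegral d α (fun x => clamp m (u x)) ≤
      dirichletForm d α u := fun m => by
    have hfin : hardyIntegral d α (fun x => clamp m (u x)) < ⊤ := by
      refine hardyIntegral_lt_top_of_bounded hα hαd (by fun_prop)
        ((lintegral_mono fun x => ENNReal.ofReal_le_ofReal ?_).trans_lt hL2) (m := m)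
        (fun x => by rw [abs_clamp]; exact min_le_right _ _)
      rw [hsq, ← sq_abs (u x)]
      exact pow_le_pow_left₀ (le_min (abs_nonneg _) m.cast_nonneg) (min_le_left _ _) 2
    refine le_trans ?_ (dirichletForm_clamp_le hα hα2 m u)
    rw [dirichletForm_eq_of_hardyIntegral_lt_top hα hα2 hm0.le hm2 (by fun_prop) hfin]
    exact le_self_add
  have hlim : Tendsto (fun m : ℕ => hardyIntegral d α (fun x => clamp m (u x))) atTop
      (𝓝 (hardyIntegral d α u)) := by
    simp_rw [hardyIntegral_eq]
    refine lintegral_tendsto_of_tendsto_of_monotone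
      (fun m => Measurable.aemeasurable (by fun_prop))
      (Eventually.of_forall fun x m n hmn => ENNReal.ofReal_le_ofReal ?_)
      (Eventually.of_forall fun x => ?_)
    · simp only [hsq]
      have : (m : ℝ) ≤ n := by exact_mod_cast hmn
      have h0 : 0 ≤ min |u x| m := le_min (abs_nonneg _) m.cast_nonneg
      gcongr
    · obtain ⟨N, hN⟩ := exists_nat_ge |u x|
      refine tendsto_const_nhds.congr' ?_
      filter_upwards [eventually_ge_atTop N] with n hn
      have : (N : ℝ) ≤ n := by exact_mod_cast hn
      rw [hsq, min_eq_left (hN.trans this), sq_abs]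
  have hfin := le_of_tendsto' (ENNReal.Tendsto.const_mul hlim (Or.inr ENNReal.ofReal_ne_top)) hle
  by_contra hH
  rw [not_lt_top_iff] at hH
  rw [hH, ENNReal.mul_top (ENNReal.ofReal_pos.2 hCpos).ne', top_le_iff] at hfin
  exact hE.ne hfin

end Hardy

/-! ### A discrete Hardy inequality -/

/-- A sequence that tends to zero is controlled, in a growing weighted `ℓ²` norm, by its increments
`w k - w (k + 1)`. -/
theorem summable_of_le_succ_add {w e : ℕ → ℝ} {r : ℝ} (hr : 1 < r) (hw0 : ∀ k, 0 ≤ w k)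
    (hwe : ∀ k, w k ≤ w (k + 1) + e k) (hw : Tendsto w atTop (𝓝 0))
    (he : Summable fun k => (r ^ k * e k) ^ 2) : Summable fun k => (r ^ k * w k) ^ 2 := by
  have hr0 : 0 < r := by linarith
  have hr1 : 0 < r - 1 := by linarith
  set Q := ∑' k, (r ^ k * e k) ^ 2 with hQ
  have hQ0 : 0 ≤ Q := tsum_nonneg fun k => sq_nonneg _
  set F := √Q with hF
  have hF0 : 0 ≤ F := Real.sqrt_nonneg _
  have hfF : ∀ k, r ^ k * e k ≤ F := fun k =>
    Real.le_sqrt_of_sq_le (he.le_tsum k fun _ _ => sq_nonneg _)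
  set B := F * (r / (r - 1)) with hB
  have hB0 : 0 ≤ B := by positivity
  -- `w k - B r^{-k}` is nondecreasing and tends to zero, hence is nonpositive
  have hbB : ∀ k, r ^ k * w k ≤ B := fun k => by
    have hmono : Monotone fun k => w k - B * (r⁻¹) ^ k := by
      refine monotone_nat_of_le_succ fun k => ?_
      have h1 : e k ≤ F * (r⁻¹) ^ k := by
        rw [inv_pow, ← div_eq_mul_inv, le_div_iff₀ (by positivity), mul_comm]
        exact hfF k
      have h2 : B * (r⁻¹) ^ k - B * (r⁻¹) ^ (k + 1) = F * (r⁻¹) ^ k := by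
        rw [hB, pow_succ]; field_simp
      linarith [hwe k]
    have hlim : Tendsto (fun k => w k - B * (r⁻¹) ^ k) atTop (𝓝 0) := by
      simpa using hw.sub ((tendsto_pow_atTop_nhds_zero_of_lt_one (by positivity)
        (inv_lt_one_of_one_lt₀ hr)).const_mul B)
    have h3 := hmono.ge_of_tendsto hlim k
    have h4 : w k ≤ B * (r⁻¹) ^ k := by linarith
    rw [inv_pow, ← div_eq_mul_inv, le_div_iff₀ (by positivity)] at h4
    linarith
  -- with `b k = r^k w k`, the bound `b k ≤ σ b (k+1) + r^k e k` is squared by convexity and summed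
  set σ := r⁻¹ with hσ
  have hσ0 : 0 < σ := by positivity
  have hσ1 : σ < 1 := inv_lt_one_of_one_lt₀ hr
  have hσ2 : 0 < 1 - σ := by linarith
  have hstep : ∀ k, (r ^ k * w k) ^ 2 ≤
      σ * (r ^ (k + 1) * w (k + 1)) ^ 2 + (r ^ k * e k) ^ 2 / (1 - σ) := fun k => by
    have h1 : r ^ k * w k ≤ σ * (r ^ (k + 1) * w (k + 1)) + r ^ k * e k := by
      have : σ * (r ^ (k + 1) * w (k + 1)) = r ^ k * w (k + 1) := by
        rw [hσ, pow_succ]; field_simp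
      rw [this, ← mul_add]
      exact mul_le_mul_of_nonneg_left (hwe k) (by positivity)
    have h0 : 0 ≤ r ^ k * w k := mul_nonneg (by positivity) (hw0 k)
    set b := r ^ (k + 1) * w (k + 1)
    set f := r ^ k * e k
    have h2 : (σ * b + f) ^ 2 ≤ σ * b ^ 2 + f ^ 2 / (1 - σ) := by
      rw [← sub_nonneg]
      have : σ * b ^ 2 + f ^ 2 / (1 - σ) - (σ * b + f) ^ 2 =
          σ / (1 - σ) * ((1 - σ) * b - f) ^ 2 := by field_simp; ring
      rw [this]; positivity
    exact (pow_le_pow_left₀ h0 h1 2).trans h2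
  refine summable_of_sum_range_le (c := (σ * B ^ 2 + Q / (1 - σ)) / (1 - σ))
    (fun k => sq_nonneg _) fun N => ?_
  have h1 : ∑ k ∈ Finset.range N, (r ^ k * w k) ^ 2 ≤
      σ * ∑ k ∈ Finset.range N, (r ^ (k + 1) * w (k + 1)) ^ 2 +
        (∑ k ∈ Finset.range N, (r ^ k * e k) ^ 2) / (1 - σ) := by
    rw [Finset.mul_sum, Finset.sum_div, ← Finset.sum_add_distrib]
    exact Finset.sum_le_sum fun k _ => hstep k
  have h2 : ∑ k ∈ Finset.range N, (r ^ (k + 1) * w (k + 1)) ^ 2 ≤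
      ∑ k ∈ Finset.range N, (r ^ k * w k) ^ 2 + B ^ 2 := by
    have h3 : (r ^ N * w N) ^ 2 ≤ B ^ 2 :=
      pow_le_pow_left₀ (mul_nonneg (by positivity) (hw0 N)) (hbB N) 2
    have h4 := Finset.sum_range_succ (fun k => (r ^ k * w k) ^ 2) N
    have h5 := Finset.sum_range_succ' (fun k => (r ^ k * w k) ^ 2) N
    have h6 := sq_nonneg (r ^ 0 * w 0)
    linarith
  have h3 : (∑ k ∈ Finset.range N, (r ^ k * e k) ^ 2) / (1 - σ) ≤ Q / (1 - σ) := by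
    gcongr
    exact he.sum_le_tsum _ fun _ _ => sq_nonneg _
  rw [le_div_iff₀ hσ2]
  nlinarith

/-! ### Dyadic shells and the remainder for `β = 0` -/

section Shells

variable {d : ℕ} {α : ℝ}

/-- The dyadic shell `2^{-k-1} < |x| ≤ 2^{-k}`. -/
def shell (d k : ℕ) : Set (EuclideanSpace ℝ (Fin d)) :=
  {x | (1 / 2 : ℝ) ^ (k + 1) < ‖x‖ ∧ ‖x‖ ≤ (1 / 2 : ℝ) ^ k}

theorem measurableSet_shell (k : ℕ) : MeasurableSet (shell d k) :=
  (measurableSet_lt measurable_const measurable_norm).inter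
    (measurableSet_le measurable_norm measurable_const)

theorem pairwise_disjoint_shell : Pairwise (Function.onFun Disjoint (shell d)) := by
  refine (pairwise_disjoint_on _).2 fun m n hmn => ?_
  rw [Set.disjoint_left]
  intro x hx hx'
  have : (1 / 2 : ℝ) ^ n ≤ (1 / 2 : ℝ) ^ (m + 1) :=
    pow_le_pow_of_le_one (by norm_num) (by norm_num) hmn
  linarith [hx.1, hx'.2]

theorem exists_mem_shell {x : EuclideanSpace ℝ (Fin d)} (hx : x ≠ 0) (hx1 : ‖x‖ ≤ 1) :
    ∃ k, x ∈ shell d k :=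
  exists_nat_pow_near_of_lt_one (norm_pos_iff.2 hx) hx1 (by norm_num) (by norm_num)

theorem smul_mem_shell_iff (k : ℕ) (x : EuclideanSpace ℝ (Fin d)) :
    (1 / 2 : ℝ) ^ k • x ∈ shell d k ↔ x ∈ shell d 0 := by
  have h : (0 : ℝ) < (1 / 2) ^ k := by positivity
  simp only [shell, mem_ofPred_eq, norm_smul, Real.norm_of_nonneg h.le, zero_add, pow_one, pow_zero]
  rw [pow_succ, mul_lt_mul_iff_right₀ h, mul_le_iff_le_one_right h]

/-- Scaling the `k`-th shell to the shell `k = 0`. -/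
theorem setLIntegral_shell (k : ℕ) {f : EuclideanSpace ℝ (Fin d) → ℝ≥0∞} (hf : Measurable f) :
    ∫⁻ x in shell d k, f x =
      ENNReal.ofReal (((1 / 2 : ℝ) ^ k) ^ (d : ℝ)) *
        ∫⁻ x in shell d 0, f ((1 / 2 : ℝ) ^ k • x) := by
  rw [← lintegral_indicator (measurableSet_shell k), ← lintegral_indicator (measurableSet_shell 0),
    lintegral_eq_lintegral_smul_map _ (hf.indicator (measurableSet_shell k))
      (by positivity : (0 : ℝ) < (1 / 2) ^ k) (LinearIsometryEquiv.refl ℝ _)]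
  congr 1
  refine lintegral_congr fun x => ?_
  rw [LinearIsometryEquiv.coe_refl, id_eq]
  by_cases hx : x ∈ shell d 0
  · rw [indicator_of_mem hx, indicator_of_mem ((smul_mem_shell_iff k x).2 hx)]
  · rw [indicator_of_notMem hx, indicator_of_notMem (mt (smul_mem_shell_iff k x).1 hx)]

theorem volume_shell_zero_ne_top : volume (shell d 0) ≠ ⊤ := by
  refine ((measure_mono (t := Metric.closedBall 0 1) fun x hx => ?_).trans_lt
    measure_closedBall_lt_top).ne
  simpa [shell] using hx.2

theorem volume_shell_zero_ne_zero (hd : 0 < d) : volume (shell d 0) ≠ 0 := by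
  obtain ⟨e, he⟩ := exists_norm_eq_one hd
  have hopen : IsOpen {x : EuclideanSpace ℝ (Fin d) | 1 / 2 < ‖x‖ ∧ ‖x‖ < 1} :=
    (isOpen_lt continuous_const continuous_norm).inter
      (isOpen_lt continuous_norm continuous_const)
  have hne : {x : EuclideanSpace ℝ (Fin d) | 1 / 2 < ‖x‖ ∧ ‖x‖ < 1}.Nonempty :=
    ⟨(3 / 4 : ℝ) • e, by simp [norm_smul, he]; norm_num⟩
  have := hopen.measure_pos volume hne
  refine (this.trans_le (measure_mono fun x hx => ?_)).ne'
  exact ⟨by simpa using hx.1, by simpa using hx.2.le⟩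

theorem sum_setLIntegral_shell_le (f : EuclideanSpace ℝ (Fin d) → ℝ≥0∞) :
    ∑' k, ∫⁻ x in shell d k, f x ≤ ∫⁻ x, f x := by
  rw [← lintegral_iUnion measurableSet_shell pairwise_disjoint_shell]
  exact setLIntegral_le_lintegral _ _

/-- The `L²` triangle inequality on a product of two copies of the same measure. -/
theorem lintegral_sq_rpow_half_le {X : Type*} [MeasurableSpace X] {μ : Measure X}
    [SFinite μ] {f g : X → ℝ} (hf : Measurable f) (hg : Measurable g) :
    (μ univ * ∫⁻ x, ENNReal.ofReal (f x ^ 2) ∂μ) ^ (1 / 2 : ℝ) ≤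
      (μ univ * ∫⁻ x, ENNReal.ofReal (g x ^ 2) ∂μ) ^ (1 / 2 : ℝ) +
        (∫⁻ x, ∫⁻ y, ENNReal.ofReal ((f x - g y) ^ 2) ∂μ ∂μ) ^ (1 / 2 : ℝ) := by
  have hsq : ∀ a : ℝ, ENNReal.ofReal |a| ^ (2 : ℝ) = ENNReal.ofReal (a ^ 2) := fun a => by
    rw [ENNReal.ofReal_rpow_of_nonneg (abs_nonneg a) two_pos.le, Real.rpow_two, sq_abs]
  have h := ENNReal.lintegral_Lp_add_le (μ := μ.prod μ) (p := 2)
    (f := fun p : X × X => ENNReal.ofReal |g p.2|)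
    (g := fun p : X × X => ENNReal.ofReal |f p.1 - g p.2|)
    (Measurable.aemeasurable (by fun_prop)) (Measurable.aemeasurable (by fun_prop)) one_le_two
  simp only [Pi.add_apply, hsq] at h
  rw [lintegral_prod _ (Measurable.aemeasurable (by fun_prop)),
    lintegral_prod (fun p : X × X => ENNReal.ofReal (g p.2 ^ 2))
      (Measurable.aemeasurable (by fun_prop)),
    lintegral_prod (fun p : X × X => ENNReal.ofReal ((f p.1 - g p.2) ^ 2))
      (Measurable.aemeasurable (by fun_prop))] at h
  simp only [lintegral_const] at h
  rw [mul_comm (∫⁻ x, _ ∂μ) (μ univ)] at h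
  refine le_trans (ENNReal.rpow_le_rpow ?_ (by norm_num)) h
  calc μ univ * ∫⁻ x, ENNReal.ofReal (f x ^ 2) ∂μ
      = ∫⁻ x, ∫⁻ _y, ENNReal.ofReal (f x ^ 2) ∂μ ∂μ := by
        simp only [lintegral_const]
        rw [lintegral_mul_const _ (by fun_prop), mul_comm]
    _ ≤ _ := by
        refine lintegral_mono fun x => lintegral_mono fun y => ?_
        rw [← hsq]
        refine ENNReal.rpow_le_rpow ?_ two_pos.le
        rw [← ENNReal.ofReal_add (abs_nonneg _) (abs_nonneg _)]
        refine ENNReal.ofReal_le_ofReal ?_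
        have := abs_add_le (g y) (f x - g y)
        rwa [add_sub_cancel] at this

/-- A lower bound for the remainder at `β = 0`, obtained by keeping only the interaction between
neighbouring shells, each scaled to the shell `k = 0`. -/
theorem sum_shell_le_remainder (hα : 0 < α) (hα2 : α < 2) (hαd : α < d)
    {u : EuclideanSpace ℝ (Fin d) → ℝ} (hu : Measurable u) :
    ∃ c : ℝ, 0 < c ∧ ENNReal.ofReal c * ∑' k : ℕ, ENNReal.ofReal ((2 : ℝ) ^ (k * (d - α))) *
      ∫⁻ x in shell d 0, ∫⁻ y in shell d 0, ENNReal.ofReal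
        ((u ((1 / 2 : ℝ) ^ k • x) / weight d α 0 ((1 / 2 : ℝ) ^ k • x) -
          u ((1 / 2 : ℝ) ^ (k + 1) • y) / weight d α 0 ((1 / 2 : ℝ) ^ (k + 1) • y)) ^ 2) ≤
      remainder d α 0 u := by
  have hN : 0 < normConst d α := normConst_pos hα hα2
  have hd0 : (0 : ℝ) < d := hα.trans hαd
  set v : EuclideanSpace ℝ (Fin d) → ℝ := fun x => u x / weight d α 0 x with hv
  have hvm : Measurable v := by simp only [hv]; fun_prop
  set c₀ : ℝ := normConst d α * 2 ^ (-(d : ℝ) - α) with hc₀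
  have hc₀pos : 0 < c₀ := by positivity
  set T : EuclideanSpace ℝ (Fin d) → EuclideanSpace ℝ (Fin d) → ℝ≥0∞ := fun x y =>
    ENNReal.ofReal ((v x - v y) ^ 2 * weight d α 0 x * weight d α 0 y * nu d α x y) with hT
  have hTm : Measurable (Function.uncurry T) := by
    simp only [hT]; fun_prop
  refine ⟨1 / 2 * (c₀ * (1 / 2) ^ (d : ℝ)), by positivity, ?_⟩
  rw [ENNReal.ofReal_mul (by positivity), mul_assoc, remainder,
    ENNReal.ofReal_div_of_pos two_pos, ENNReal.ofReal_one, ENNReal.ofReal_ofNat]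
  refine mul_le_mul_right ?_ _
  rw [← ENNReal.tsum_mul_left]
  have hpoint : ∀ k : ℕ, ∀ x ∈ shell d 0, ∀ y ∈ shell d 0,
      ENNReal.ofReal (c₀ * ((1 / 2 : ℝ) ^ k) ^ (-2 * (d - α) - d - α)) *
        ENNReal.ofReal ((v ((1 / 2 : ℝ) ^ k • x) - v ((1 / 2 : ℝ) ^ (k + 1) • y)) ^ 2) ≤
      T ((1 / 2 : ℝ) ^ k • x) ((1 / 2 : ℝ) ^ (k + 1) • y) := by
    intro k x hx y hy
    rw [← smul_mem_shell_iff k] at hx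
    rw [← smul_mem_shell_iff (k + 1)] at hy
    set X := (1 / 2 : ℝ) ^ k • x
    set Y := (1 / 2 : ℝ) ^ (k + 1) • y
    set s : ℝ := (1 / 2 : ℝ) ^ k with hs
    have hs0 : 0 < s := by positivity
    have hs1 : (1 / 2 : ℝ) ^ (k + 1) = s / 2 := by rw [hs, pow_succ]; ring
    obtain ⟨hX1, hX2⟩ := hx
    obtain ⟨hY1, hY2⟩ := hy
    rw [hs1] at hX1 hY2
    have hX0 : 0 < ‖X‖ := by linarith
    have hY0 : 0 < ‖Y‖ := (by positivity : (0 : ℝ) < (1 / 2) ^ (k + 1 + 1)).trans hY1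
    have hXY0 : 0 < ‖Y - X‖ := by
      have := norm_sub_norm_le X Y
      rw [norm_sub_rev] at this
      linarith
    have hXY : ‖Y - X‖ ≤ 2 * s := by
      have := norm_sub_le Y X
      linarith
    rw [← ENNReal.ofReal_mul (by positivity)]
    refine ENNReal.ofReal_le_ofReal ?_
    have hw : ∀ z : EuclideanSpace ℝ (Fin d), 0 < ‖z‖ → ‖z‖ ≤ s →
        s ^ (-(d - α)) ≤ weight d α 0 z := fun z hz hzs => by
      rw [weight, zero_add, mul_one, neg_sub]
      exact Real.rpow_le_rpow_of_nonpos hz hzs (by linarith)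
    have h1 := hw X hX0 hX2
    have h2 := hw Y hY0 (by linarith)
    have hwX : 0 ≤ weight d α 0 X := le_trans (by positivity) h1
    have hwY : 0 ≤ weight d α 0 Y := le_trans (by positivity) h2
    have h3 : c₀ * s ^ (-(d : ℝ) - α) ≤ nu d α X Y := by
      rw [nu, hc₀, mul_assoc, ← Real.mul_rpow two_pos.le hs0.le]
      exact mul_le_mul_of_nonneg_left
        (Real.rpow_le_rpow_of_nonpos hXY0 hXY (by linarith)) hN.le
    have h4 : s ^ (-2 * (d - α) - d - α) =
        s ^ (-(d - α)) * s ^ (-(d - α)) * s ^ (-(d : ℝ) - α) := by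
      rw [← Real.rpow_add hs0, ← Real.rpow_add hs0]; congr 1; ring
    calc c₀ * s ^ (-2 * (d - α) - d - α) * (v X - v Y) ^ 2
        = (v X - v Y) ^ 2 * s ^ (-(d - α)) * s ^ (-(d - α)) * (c₀ * s ^ (-(d : ℝ) - α)) := by
          rw [h4]; ring
      _ ≤ _ := by gcongr
  have hshell : ∀ k : ℕ, ENNReal.ofReal (c₀ * (1 / 2) ^ (d : ℝ)) *
      (ENNReal.ofReal ((2 : ℝ) ^ (k * (d - α))) * ∫⁻ x in shell d 0, ∫⁻ y in shell d 0,
        ENNReal.ofReal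
          ((v ((1 / 2 : ℝ) ^ k • x) - v ((1 / 2 : ℝ) ^ (k + 1) • y)) ^ 2)) ≤
      ∫⁻ x in shell d k, ∫⁻ y, T x y := by
    intro k
    have hm1 : Measurable fun x => ∫⁻ y in shell d (k + 1), T x y := hTm.lintegral_prod_right'
    have hm2 : Measurable (Function.uncurry fun x y : EuclideanSpace ℝ (Fin d) => ENNReal.ofReal
        ((v ((1 / 2 : ℝ) ^ k • x) - v ((1 / 2 : ℝ) ^ (k + 1) • y)) ^ 2)) := by fun_prop
    have hm3 : Measurable fun x => ∫⁻ y in shell d 0, ENNReal.ofReal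
        ((v ((1 / 2 : ℝ) ^ k • x) - v ((1 / 2 : ℝ) ^ (k + 1) • y)) ^ 2) :=
      hm2.lintegral_prod_right'
    set s : ℝ := (1 / 2 : ℝ) ^ k with hs
    have hs0 : 0 < s := by positivity
    have hs1 : (1 / 2 : ℝ) ^ (k + 1) = 1 / 2 * s := by rw [hs, pow_succ]; ring
    have hs2 : (2 : ℝ) ^ (k * (d - α)) = s ^ (-(d - α)) := by
      rw [hs, ← Real.rpow_natCast, ← Real.rpow_mul (by norm_num), one_div,
        Real.inv_rpow two_pos.le, ← Real.rpow_neg two_pos.le]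
      congr 1; ring
    calc _ = ENNReal.ofReal (s ^ (d : ℝ)) * (ENNReal.ofReal (((1 / 2 : ℝ) ^ (k + 1)) ^ (d : ℝ)) *
          (ENNReal.ofReal (c₀ * s ^ (-2 * (d - α) - d - α)) * ∫⁻ x in shell d 0,
          ∫⁻ y in shell d 0, ENNReal.ofReal
            ((v (s • x) - v ((1 / 2 : ℝ) ^ (k + 1) • y)) ^ 2))) := by
          rw [← mul_assoc, ← mul_assoc, ← mul_assoc, ← ENNReal.ofReal_mul (by positivity),
            ← ENNReal.ofReal_mul (by positivity), ← ENNReal.ofReal_mul (by positivity)]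
          congr 2
          rw [hs2, hs1, Real.mul_rpow (by norm_num) hs0.le]
          have : s ^ (-(d - α)) = s ^ (d : ℝ) * s ^ (d : ℝ) * s ^ (-2 * (d - α) - d - α) := by
            rw [← Real.rpow_add hs0, ← Real.rpow_add hs0]; congr 1; ring
          rw [this]; ring
      _ ≤ ENNReal.ofReal (s ^ (d : ℝ)) * (ENNReal.ofReal (((1 / 2 : ℝ) ^ (k + 1)) ^ (d : ℝ)) *
          ∫⁻ x in shell d 0, ∫⁻ y in shell d 0, T (s • x) ((1 / 2 : ℝ) ^ (k + 1) • y)) := by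
          gcongr
          rw [← lintegral_const_mul _ hm3]
          refine setLIntegral_mono' (measurableSet_shell 0) fun x hx => ?_
          rw [← lintegral_const_mul _ (by fun_prop)]
          exact setLIntegral_mono' (measurableSet_shell 0) fun y hy => hpoint k x hx y hy
      _ = ∫⁻ x in shell d k, ∫⁻ y in shell d (k + 1), T x y := by
          rw [setLIntegral_shell k hm1]
          simp_rw [fun x => setLIntegral_shell (k + 1) (f := T x) hTm.of_uncurry_left]
          have hm4 : Measurable (Function.uncurry fun x y : EuclideanSpace ℝ (Fin d) =>
              T (s • x) ((1 / 2 : ℝ) ^ (k + 1) • y)) := by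
            simp only [hT]; fun_prop
          have hm5 : Measurable fun x => ∫⁻ y in shell d 0,
              T (s • x) ((1 / 2 : ℝ) ^ (k + 1) • y) := hm4.lintegral_prod_right'
          rw [lintegral_const_mul _ hm5]
      _ ≤ _ := lintegral_mono fun x => setLIntegral_le_lintegral _ _
  exact (ENNReal.tsum_le_tsum hshell).trans (sum_setLIntegral_shell_le _)

end Shells

section Remainder

variable {d : ℕ} {α β : ℝ}

theorem toReal_rpow_half_sq (a : ℝ≥0∞) : (a ^ (1 / 2 : ℝ)).toReal ^ 2 = a.toReal := by
  rw [← ENNReal.toReal_pow, ← ENNReal.rpow_natCast, ← ENNReal.rpow_mul]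
  norm_num

/-- For `β = 0` and `d ≥ 2α`, a square integrable function with finite remainder has a finite
Hardy integral. Let `w k` be, up to a constant, the `L²` mean of `u / h` over the `k`-th dyadic shell. The remainder
controls `∑ 2^{k(d-α)} (w k - w (k+1))²`, and `w k → 0`, because `h` is not square integrable at the
origin when `d ≥ 2α`. The discrete Hardy inequality then bounds `∑ 2^{k(d-α)} (w k)²`, which is
comparable to the Hardy integral over the unit ball. -/
theorem hardyIntegral_lt_top_of_remainder (hα : 0 < α) (hα2 : α < 2) (hαd : 2 * α ≤ d)
    {u : EuclideanSpace ℝ (Fin d) → ℝ} (hu : Measurable u)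
    (hL2 : ∫⁻ x, ENNReal.ofReal (u x ^ 2) < ⊤) (hR : remainder d α 0 u < ⊤) :
    hardyIntegral d α u < ⊤ := by
  have hd0 : (0 : ℝ) < d := by linarith
  have hd : 0 < d := by exact_mod_cast hd0
  set q : ℝ := d - α with hq
  have hq0 : 0 < q := by linarith
  set v : EuclideanSpace ℝ (Fin d) → ℝ := fun x => u x / weight d α 0 x with hv
  have hvm : Measurable v := by simp only [hv]; fun_prop
  have hweight : ∀ x : EuclideanSpace ℝ (Fin d), weight d α 0 x = ‖x‖ ^ (-q) := fun x => by
    rw [weight, hq, zero_add, mul_one, neg_sub]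
  have huv : ∀ x : EuclideanSpace ℝ (Fin d), x ≠ 0 → u x = v x * ‖x‖ ^ (-q) := fun x hx => by
    rw [← hweight, hv]
    exact (div_mul_cancel₀ _ (weight_pos hx).ne').symm
  set M := volume (shell d 0) with hM
  have hMtop : M ≠ ⊤ := volume_shell_zero_ne_top
  have hM0 : M ≠ 0 := volume_shell_zero_ne_zero hd
  set W : ℕ → ℝ≥0∞ := fun k =>
    ∫⁻ x in shell d 0, ENNReal.ofReal (v ((1 / 2 : ℝ) ^ k • x) ^ 2) with hW
  set D : ℕ → ℝ≥0∞ := fun k => ∫⁻ x in shell d 0, ∫⁻ y in shell d 0,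
    ENNReal.ofReal ((v ((1 / 2 : ℝ) ^ k • x) - v ((1 / 2 : ℝ) ^ (k + 1) • y)) ^ 2) with hD
  set ρ : ℕ → ℝ≥0∞ := fun k => ENNReal.ofReal ((2 : ℝ) ^ (k * q)) with hρ
  have hρ0 : ∀ k, ρ k ≠ 0 := fun k => (ENNReal.ofReal_pos.2 (by positivity)).ne'
  have hDsum : ∑' k, ρ k * D k ≠ ⊤ := by
    obtain ⟨c, hc, hcR⟩ := sum_shell_le_remainder hα hα2 (by linarith : α < d) hu
    intro htop
    change ENNReal.ofReal c * ∑' k, ρ k * D k ≤ _ at hcR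
    rw [htop, ENNReal.mul_top (ENNReal.ofReal_pos.2 hc).ne', top_le_iff] at hcR
    exact hR.ne hcR
  have hDtop : ∀ k, D k ≠ ⊤ := fun k hk => by
    have := ENNReal.ne_top_of_tsum_ne_top hDsum k
    rw [hk, ENNReal.mul_top (hρ0 k)] at this
    exact this rfl
  -- on the `k`-th shell `v² ≤ 2^{-kd} u²`, by `d ≥ 2 α`; the factor `2^{-kd}` comes from the scaling
  have hWle : ∀ k, W k ≤ ∫⁻ x in shell d k, ENNReal.ofReal (u x ^ 2) := fun k => by
    rw [setLIntegral_shell k (by fun_prop), ← lintegral_const_mul _ (by fun_prop)]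
    refine setLIntegral_mono' (measurableSet_shell 0) fun x hx => ?_
    rw [← smul_mem_shell_iff k] at hx
    rw [← ENNReal.ofReal_mul (by positivity)]
    refine ENNReal.ofReal_le_ofReal ?_
    set X := (1 / 2 : ℝ) ^ k • x
    set s : ℝ := (1 / 2 : ℝ) ^ k with hs
    have hs0 : 0 < s := by positivity
    have hs1 : s ≤ 1 := pow_le_one₀ (by norm_num) (by norm_num)
    have hX0 : 0 < ‖X‖ := (by positivity : (0 : ℝ) < (1 / 2) ^ (k + 1)).trans hx.1
    have h1 : s ^ (-q) ≤ ‖X‖ ^ (-q) := Real.rpow_le_rpow_of_nonpos hX0 hx.2 (by linarith)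
    have h2 : 1 ≤ s ^ (d : ℝ) * (s ^ (-q)) ^ 2 := by
      rw [← Real.rpow_natCast, ← Real.rpow_mul hs0.le, ← Real.rpow_add hs0]
      exact Real.one_le_rpow_of_pos_of_le_one_of_nonpos hs0 hs1 (by push_cast; linarith)
    calc v X ^ 2 = v X ^ 2 * 1 := (mul_one _).symm
      _ ≤ v X ^ 2 * (s ^ (d : ℝ) * (‖X‖ ^ (-q)) ^ 2) := by
        refine mul_le_mul_of_nonneg_left (h2.trans ?_) (sq_nonneg _)
        gcongr
      _ = s ^ (d : ℝ) * u X ^ 2 := by rw [huv X (norm_pos_iff.1 hX0)]; ring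
  have hWsum : ∑' k, W k ≠ ⊤ :=
    (((ENNReal.tsum_le_tsum hWle).trans (sum_setLIntegral_shell_le _)).trans_lt hL2).ne
  have hWtop : ∀ k, W k ≠ ⊤ := ENNReal.ne_top_of_tsum_ne_top hWsum
  have hWlim : Tendsto W atTop (𝓝 0) := ENNReal.tendsto_atTop_zero_of_tsum_ne_top hWsum
  -- on the `k`-th shell `|x|^{-α} u²` is at most a multiple of `2^{kd} 2^{k(d-α)} v²`, and the
  -- scaling contributes `2^{-kd}`
  have hHle : ∀ k, ∫⁻ x in shell d k, ENNReal.ofReal (u x ^ 2 * ‖x‖ ^ (-α)) ≤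
      ENNReal.ofReal (2 ^ (2 * q + α)) * (ρ k * W k) := fun k => by
    have hm : Measurable fun x : EuclideanSpace ℝ (Fin d) =>
        ENNReal.ofReal (v ((1 / 2 : ℝ) ^ k • x) ^ 2) := by fun_prop
    rw [setLIntegral_shell k (by fun_prop), ← lintegral_const_mul _ (by fun_prop), ← mul_assoc,
      ← lintegral_const_mul _ hm]
    refine setLIntegral_mono' (measurableSet_shell 0) fun x hx => ?_
    rw [← smul_mem_shell_iff k] at hx
    rw [← ENNReal.ofReal_mul (by positivity), ← ENNReal.ofReal_mul (by positivity),
      ← ENNReal.ofReal_mul (by positivity)]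
    refine ENNReal.ofReal_le_ofReal ?_
    set X := (1 / 2 : ℝ) ^ k • x
    set s : ℝ := (1 / 2 : ℝ) ^ k with hs
    have hs0 : 0 < s := by positivity
    have hs1 : (1 / 2 : ℝ) ^ (k + 1) = s / 2 := by rw [hs, pow_succ]; ring
    have hX1 : s / 2 ≤ ‖X‖ := hs1 ▸ hx.1.le
    have hX0 : 0 < ‖X‖ := (half_pos hs0).trans_le hX1
    have h1 : ‖X‖ ^ (-q) ≤ (s / 2) ^ (-q) :=
      Real.rpow_le_rpow_of_nonpos (half_pos hs0) hX1 (by linarith)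
    have h2 : ‖X‖ ^ (-α) ≤ (s / 2) ^ (-α) :=
      Real.rpow_le_rpow_of_nonpos (half_pos hs0) hX1 (by linarith)
    have h3 : s ^ (d : ℝ) * (((s / 2) ^ (-q)) ^ 2 * (s / 2) ^ (-α)) =
        2 ^ (2 * q + α) * 2 ^ (k * q) := by
      have e1 : ((s / 2) ^ (-q)) ^ 2 * (s / 2) ^ (-α) = (s / 2) ^ (-(2 * q + α)) := by
        rw [← Real.rpow_natCast, ← Real.rpow_mul (half_pos hs0).le,
          ← Real.rpow_add (half_pos hs0)]
        congr 1; push_cast; ring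
      have e2 : (2 : ℝ) ^ (k * q) = s ^ (-q) := by
        rw [hs, ← Real.rpow_natCast, ← Real.rpow_mul (by norm_num), one_div,
          Real.inv_rpow two_pos.le, ← Real.rpow_neg two_pos.le]
        congr 1; ring
      have e3 : s ^ (-q) = s ^ (d : ℝ) * s ^ (-(2 * q + α)) := by
        rw [← Real.rpow_add hs0]; congr 1; rw [hq]; ring
      rw [e1, e2, e3, Real.div_rpow hs0.le two_pos.le, Real.rpow_neg two_pos.le]
      field_simp
    calc s ^ (d : ℝ) * (u X ^ 2 * ‖X‖ ^ (-α))
        = s ^ (d : ℝ) * (v X ^ 2 * ((‖X‖ ^ (-q)) ^ 2 * ‖X‖ ^ (-α))) := by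
          rw [huv X (norm_pos_iff.1 hX0)]; ring
      _ ≤ s ^ (d : ℝ) * (v X ^ 2 * (((s / 2) ^ (-q)) ^ 2 * (s / 2) ^ (-α))) := by gcongr
      _ = _ := by rw [← h3]; ring
  -- the discrete Hardy inequality, with ratio `r² = 2^{d-α}`
  set r : ℝ := 2 ^ (q / 2) with hr
  have hr1 : 1 < r := Real.one_lt_rpow one_lt_two (by positivity)
  have hrρ : ∀ k : ℕ, ∀ a : ℝ≥0∞, (r ^ k * (a ^ (1 / 2 : ℝ)).toReal) ^ 2 = (ρ k * a).toReal :=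
    fun k a => by
    rw [mul_pow, toReal_rpow_half_sq, ENNReal.toReal_mul, hρ,
      ENNReal.toReal_ofReal (by positivity), hr, ← Real.rpow_natCast, ← Real.rpow_natCast,
      ← Real.rpow_mul two_pos.le, ← Real.rpow_mul two_pos.le]
    congr 2; push_cast; ring
  have hMW : ∀ k, (M * W k) ^ (1 / 2 : ℝ) ≠ ⊤ := fun k =>
    ENNReal.rpow_ne_top_of_nonneg (by norm_num) (ENNReal.mul_ne_top hMtop (hWtop k))
  have hDk : ∀ k, D k ^ (1 / 2 : ℝ) ≠ ⊤ := fun k =>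
    ENNReal.rpow_ne_top_of_nonneg (by norm_num) (hDtop k)
  have hsum := summable_of_le_succ_add (w := fun k => ((M * W k) ^ (1 / 2 : ℝ)).toReal)
    (e := fun k => (D k ^ (1 / 2 : ℝ)).toReal) hr1 (fun k => ENNReal.toReal_nonneg)
    (fun k => ?_) ?_ ?_
  · have hsum' : Summable fun k => (ρ k * (M * W k)).toReal := by simpa only [hrρ] using hsum
    have e : ∀ k, ENNReal.ofReal (ρ k * (M * W k)).toReal = M * (ρ k * W k) := fun k => by
      rw [ENNReal.ofReal_toReal
        (ENNReal.mul_ne_top ENNReal.ofReal_ne_top (ENNReal.mul_ne_top hMtop (hWtop k)))]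
      ring
    have h1 : M * ∑' k, ρ k * W k ≠ ⊤ := by
      rw [← ENNReal.tsum_mul_left, ← tsum_congr e]
      exact hsum'.tsum_ofReal_ne_top
    have h2 : ∑' k, ρ k * W k ≠ ⊤ := fun h => by
      rw [h, ENNReal.mul_top hM0] at h1
      exact h1 rfl
    rw [hardyIntegral_eq]
    have hcover : ∀ᵐ x : EuclideanSpace ℝ (Fin d), x ∈ {x | 1 < ‖x‖} ∪ ⋃ k, shell d k := by
      filter_upwards [ae_ne_zero_of_finrank_pos (V := EuclideanSpace ℝ (Fin d))
        (by simpa using hd)] with x hx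
      rcases lt_or_ge 1 ‖x‖ with h | h
      · exact Or.inl h
      · exact Or.inr (mem_iUnion.2 (exists_mem_shell hx h))
    rw [← setLIntegral_univ, ← setLIntegral_congr (eventuallyEq_univ.2 hcover)]
    refine (lintegral_union_le _ _ _).trans_lt (ENNReal.add_lt_top.2 ⟨?_, ?_⟩)
    · refine (setLIntegral_mono' (measurableSet_lt measurable_const measurable_norm)
        fun x hx => ENNReal.ofReal_le_ofReal ?_).trans_lt
          ((setLIntegral_le_lintegral _ _).trans_lt hL2)
      exact mul_le_of_le_one_right (sq_nonneg _)
        (Real.rpow_le_one_of_one_le_of_nonpos (le_of_lt hx) (by linarith))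
    · rw [lintegral_iUnion measurableSet_shell pairwise_disjoint_shell]
      refine (ENNReal.tsum_le_tsum hHle).trans_lt ?_
      rw [ENNReal.tsum_mul_left]
      exact ENNReal.mul_lt_top ENNReal.ofReal_lt_top h2.lt_top
  · have h := lintegral_sq_rpow_half_le (μ := volume.restrict (shell d 0))
      (f := fun x => v ((1 / 2 : ℝ) ^ k • x)) (g := fun y => v ((1 / 2 : ℝ) ^ (k + 1) • y))
      (by fun_prop) (by fun_prop)
    rw [Measure.restrict_apply_univ] at h
    have h' := ENNReal.toReal_mono (ENNReal.add_ne_top.2 ⟨hMW (k + 1), hDk k⟩) h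
    rwa [ENNReal.toReal_add (hMW _) (hDk _)] at h'
  · have h1 : Tendsto (fun k => (M * W k) ^ (1 / 2 : ℝ)) atTop (𝓝 0) := by
      have := (ENNReal.continuous_rpow_const (y := (1 / 2 : ℝ))).tendsto 0 |>.comp
        (by simpa using ENNReal.Tendsto.const_mul hWlim (Or.inr hMtop) :
          Tendsto (fun k => M * W k) atTop (𝓝 0))
      rwa [ENNReal.zero_rpow_of_pos (by norm_num)] at this
    have h2 := (ENNReal.tendsto_toReal ENNReal.zero_ne_top).comp h1
    rwa [ENNReal.toReal_zero] at h2
  · simp_rw [hrρ]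
    exact ENNReal.summable_toReal hDsum

end Remainder

/-! ### The Hardy identity -/

section Main

variable {d : ℕ} {α β : ℝ} {u w : EuclideanSpace ℝ (Fin d) → ℝ}

theorem hardyIntegral_congr_ae (h : u =ᵐ[volume] w) : hardyIntegral d α u = hardyIntegral d α w :=
  lintegral_congr_ae (h.mono fun x hx => by simp only [hx])

theorem dirichletForm_congr_ae (h : u =ᵐ[volume] w) :
    dirichletForm d α u = dirichletForm d α w := by
  unfold dirichletForm
  congr 1
  exact lintegral_congr_ae (h.mono fun x hx =>
    lintegral_congr_ae (h.mono fun y hy => by simp only [hx, hy]))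

theorem remainder_congr_ae (h : u =ᵐ[volume] w) :
    remainder d α β u = remainder d α β w := by
  unfold remainder
  congr 1
  exact lintegral_congr_ae (h.mono fun x hx =>
    lintegral_congr_ae (h.mono fun y hy => by simp only [hx, hy]))

/-- The Hardy identity for the Dirichlet form, in all cases. -/
theorem dirichletForm_eq (hα : 0 < α) (hα2 : α < 2) (hαd : α < d) (hβ : 0 ≤ β)
    (hβ' : β ≤ (d : ℝ) / α - 1) (hu : MemLp u 2 volume)
    (hH : β = 0 → (d : ℝ) < 2 * α → hardyIntegral d α u < ⊤) :
    dirichletForm d α u =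
      ENNReal.ofReal (hardyConst d α β) * hardyIntegral d α u + remainder d α β u := by
  wlog hum : Measurable u generalizing u
  · have hae := hu.aestronglyMeasurable.ae_eq_mk
    have := this ((memLp_congr_ae hae).1 hu) (by rwa [← hardyIntegral_congr_ae hae])
      hu.aestronglyMeasurable.stronglyMeasurable_mk.measurable
    rwa [dirichletForm_congr_ae hae, hardyIntegral_congr_ae hae, remainder_congr_ae hae]
  have hL2 : ∫⁻ x, ENNReal.ofReal (u x ^ 2) < ⊤ := hu.integrable_sq.lintegral_lt_top
  rcases hβ'.eq_or_lt with rfl | hβ1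
  · -- here the weight is constant
    have hw : ∀ x : EuclideanSpace ℝ (Fin d), weight d α (d / α - 1) x = 1 := fun x => by
      rw [weight, show α * ((d : ℝ) / α - 1 + 1) - d = 0 by field_simp; ring, Real.rpow_zero]
    simp [hardyConst_endpoint hα, remainder, dirichletForm, hw]
  have hβ2 : α * (β + 1) < d := by
    rwa [lt_sub_iff_add_lt, lt_div_iff₀ hα, mul_comm] at hβ1
  by_cases hfin : hardyIntegral d α u < ⊤
  · exact dirichletForm_eq_of_hardyIntegral_lt_top hα hα2 hβ hβ2 hum hfin
  have hE : dirichletForm d α u = ⊤ := not_lt_top_iff.1 fun h =>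
    hfin (hardyIntegral_lt_top_of_dirichletForm hα hα2 hαd hum hL2 h)
  rw [hE]
  rcases hβ.eq_or_lt with rfl | hβ0
  · have hd2 : 2 * α ≤ d := not_lt.1 fun h => hfin (hH rfl h)
    have hR : remainder d α 0 u = ⊤ := not_lt_top_iff.1 fun h =>
      hfin (hardyIntegral_lt_top_of_remainder hα hα2 hd2 hum hL2 h)
    rw [hR, add_top]
  · rw [not_lt_top_iff.1 hfin,
      ENNReal.mul_top (ENNReal.ofReal_pos.2 (hardyConst_pos hα hβ0 hβ2)).ne', top_add]

end Main

end FractionalHardy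

theorem mainTheorem3 (d : ℕ) (α : ℝ) (hα : 0 < α) (hαd : α < min (d : ℝ) 2) :
    (∀ β : ℝ, 0 ≤ β → β ≤ (d : ℝ) / α - 1 →
      ∀ u : EuclideanSpace ℝ (Fin d) → ℝ, MemLp u 2 volume →
        (β = 0 → (d : ℝ) < 2 * α → FractionalHardy.hardyIntegral d α u < ⊤) →
        FractionalHardy.dirichletForm d α u =
          ENNReal.ofReal (FractionalHardy.hardyConst d α β) * FractionalHardy.hardyIntegral d α u
            + FractionalHardy.remainder d α β u) ∧
    ((d - α) / (2 * α) ∈ Set.Icc (0 : ℝ) ((d : ℝ) / α - 1) ∧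
      IsMaxOn (FractionalHardy.hardyConst d α) (Set.Icc (0 : ℝ) ((d : ℝ) / α - 1))
        ((d - α) / (2 * α)) ∧
      FractionalHardy.hardyConst d α ((d - α) / (2 * α)) =
        2 ^ α * Real.Gamma ((d + α) / 4) ^ 2 * (Real.Gamma ((d - α) / 4) ^ 2)⁻¹) := by
  obtain ⟨hd, hα2⟩ := lt_min_iff.1 hαd
  refine ⟨fun β hβ hβ' u hu hH => FractionalHardy.dirichletForm_eq hα hα2 hd hβ hβ' hu hH,
    ⟨div_nonneg (by linarith) (by positivity), ?_⟩, fun β hβ =>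
      FractionalHardy.hardyConst_le_midpoint hα hα2 hd hβ.1 hβ.2,
    FractionalHardy.hardyConst_midpoint hα⟩
  rw [div_sub_one hα.ne', div_le_div_iff₀ (by positivity) hα]
  nlinarith [sub_pos.2 hd]
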